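/- Let $\nu\ge 3$ and let $M$ be a compact embedded $C^\nu$ submanifold of $\mathbb{R}^q$, with the induced Riemannian metric, Levi-Civita connection $\nabla$ and curvature tensor $R(X,Y)=\nabla_X\nabla_Y-\nabla_Y\nabla_X-\nabla_{[X,Y]}$. Write $S^1=\mathbb{R}/2\pi\mathbb{Z}$, let $\mathrm{W}^{2,2}_\iota(S^1,M)$ be the set of $u\in \mathrm{W}^{2,2}(S^1,\mathbb{R}^q)$ with $u(t)\in M$ and $\dot u(t)\ne 0$ for all $t$, and for such $u$ let $\mathrm{W}^{2,2}_u(S^1,TM)$ be the space of $v\in \mathrm{W}^{2,2}(S^1,\mathbb{R}^q)$ with $v(t)\in T_{u(t)}M$ for all $t$. Put $T=\dot u/|\dot u|$, $D_t=\nabla_{T}$ (derivative with respect to arc length), $K=D_tT$, $\kappa(u)=|K|$, $ds=|\dot u|\,dt$ and, for $\sigma\ge 0$, $$E_\sigma(u)=\int_{S^1}\bigl(1+\sigma^2\kappa(u)^2\bigr)|\dot u|\,dt .$$ A curve $u\in \mathrm{W}^{2,2}_\iota(S^1,M)$ is a critical point of $E_\sigma$ if $DE_\sigma(u)\cdot v=0$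 for all $v\in\mathrm{W}^{2,2}_u(S^1,TM)$. The second variation of $E_\sigma$ at a critical point $u$ in the direction $v\in\mathrm{W}^{2,2}_u(S^1,TM)$ is $$\begin{aligned} D^2E_\sigma(u)[v,v]={}&2\sigma^2\int_{S^1}\Bigl\{|D_t^2v|^2+|R(v,T)T|^2+2\bigl(6\langle D_tv,T\rangle^2-|D_tv|^2+\langle R(T,v)v,T\rangle\bigr)\kappa^2\\ &\quad-\bigl(\langle D_t^2v,T\rangle+\langle D_tv,K\rangle\bigr)^2-8\langle D_tv,T\rangle\langle D_t^2v,K\rangle+\langle(\nabla_{T}R)(v,T)v,K\rangle+\langle(\nabla_vR)(v,T)T,K\rangle\\ &\quad+\langle R(D_tv,T)v,K\rangle-\langle R(K,v)v,K\rangle+3\langle R(v,T)D_tv,K\rangle+\langle R(v,D_tv)T,K\rangle\\ &\quad+2\langle R(v,T)T,D_t^2v\rangle-8\langle D_tv,T\rangle\langle R(v,T)T,K\rangle\Bigr\}\,ds\\ &+4\sigma^2\int_{S^1}\langle D_tv,T\rangle\bigl(\langle D_t^2v,K\rangle-2\langle D_tv,T\rangle\kappa^2+\langle R(v,T)T,K\rangle\bigr)\,ds\\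 &+\int_{S^1}(1+\sigma^2\kappa^2)\bigl(|D_tv|^2-\langle D_tv,T\rangle^2-\langle R(T,v)v,T\rangle\bigr)\,ds . \end{aligned}$$ The index $\mathrm{Ind}(u)\in\mathbb{N}\cup\{\infty\}$ of a critical point $u$ of $E_\sigma$ is the largest dimension of a linear subspace of $\mathrm{W}^{2,2}_u(S^1,TM)$ on which $D^2E_\sigma(u)$ is negative definite. **Theorem.** Let $\sigma_n>0$ with $\sigma_n\to 0$ and, for each $n$, let $u_n\in\mathrm{W}^{2,2}_\iota(S^1,M)$ be a critical point of $E_{\sigma_n}$, parametrized with constant speed, such that $$\sigma_n^2\int_{S^1}\kappa(u_n)^2|\dot u_n|\,dt\longrightarrow 0 .$$ Assume that $u_n\to u$ in $L^\infty(S^1)$ and $\dot u_n\to\dot u$ almost everywhere, where $u\in\mathrm{W}^{2,2}_\iota(S^1,M)$ is a closed (non-trivial) geodesic. Then $$\mathrm{Ind}(u)\le\liminf_{n\to\infty}\mathrm{Ind}(u_n),$$ where $\mathrm{Ind}(u_n)$ is the index of $u_n$ as a critical point of $E_{\sigma_n}$ and $\mathrm{Ind}(u)$ is the index of $u$ as a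 critical point of $E_0$, the length. In particular this applies when $E_{\sigma_n}(u_n)=\beta(\sigma_n)$ are min-max values and $\sigma_n^2\int_{S^1}\kappa(u_n)^2|\dot u_n|\,dt\le 1/\log(1/\sigma_n)$ for all large $n$. -/

import Mathlib

open Set Filter Topology MeasureTheory
open scoped Real InnerProductSpace

noncomputable section

namespace ViscosityGeodesic

/-- `M` is an embedded `m`-dimensional submanifold of class `C^ν` of `ℝ^q`: around each of its
points there is a `C^ν` diffeomorphism between open subsets of `ℝ^q` that flattens `M` onto an
`m`-dimensional linear subspace. -/
def IsSubmanifold {q : ℕ} (ν : ℕ∞) (m : ℕ) (M : Set (EuclideanSpace ℝ (Fin q))) : Prop :=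
  ∀ x ∈ M, ∃ Φ : OpenPartialHomeomorph (EuclideanSpace ℝ (Fin q)) (EuclideanSpace ℝ (Fin q)),
    x ∈ Φ.source ∧ ContDiffOn ℝ ν Φ Φ.source ∧ ContDiffOn ℝ ν Φ.symm Φ.target ∧
    ∃ V : Submodule ℝ (EuclideanSpace ℝ (Fin q)), Module.finrank ℝ V = m ∧
      ∀ y ∈ Φ.source, y ∈ M ↔ Φ y ∈ V

/-- The tangent space `T_x M`, as a linear subspace of `ℝ^q`. -/
def tangentSpaceAt {q : ℕ} (M : Set (EuclideanSpace ℝ (Fin q))) (x : EuclideanSpace ℝ (Fin q)) :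
    Submodule ℝ (EuclideanSpace ℝ (Fin q)) :=
  Submodule.span ℝ (tangentConeAt ℝ M x)

/-- The orthogonal projection `P(x) : ℝ^q → T_x M`. -/
def tangentProj {q : ℕ} (M : Set (EuclideanSpace ℝ (Fin q))) (x : EuclideanSpace ℝ (Fin q)) :
    EuclideanSpace ℝ (Fin q) →L[ℝ] EuclideanSpace ℝ (Fin q) :=
  (tangentSpaceAt M x).starProjection

/-- The derivative of the map `P` along `M` at `x ∈ M` in the direction `X`. It is used only for
`X ∈ T_x M`, where it does not depend on how `P` is extended off `M`. -/
def tangentProjDeriv {q : ℕ} (M : Set (EuclideanSpace ℝ (Fin q))) (x X : EuclideanSpace ℝ (Fin q)) :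
    EuclideanSpace ℝ (Fin q) →L[ℝ] EuclideanSpace ℝ (Fin q) :=
  fderivWithin ℝ (tangentProj M) M x X

/-- The Riemann curvature tensor `R(X, Y) Z = ∇_X ∇_Y Z - ∇_Y ∇_X Z - ∇_{[X, Y]} Z` of the induced
metric. For a submanifold of `ℝ^q` one has `∇_X Z = P (∂_X Z)`, whence
`R(X, Y) Z = P ((∂_X P) (∂_Y P) Z - (∂_Y P) (∂_X P) Z)` for tangent `X, Y, Z`. The arguments are
projected first, so that for fixed `X, Y, Z ∈ ℝ^q` this is a tangent vector field on `M`. -/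
def curvature {q : ℕ} (M : Set (EuclideanSpace ℝ (Fin q)))
    (x X Y Z : EuclideanSpace ℝ (Fin q)) : EuclideanSpace ℝ (Fin q) :=
  tangentProj M x
    (tangentProjDeriv M x (tangentProj M x X)
        (tangentProjDeriv M x (tangentProj M x Y) (tangentProj M x Z))
      - tangentProjDeriv M x (tangentProj M x Y)
        (tangentProjDeriv M x (tangentProj M x X) (tangentProj M x Z)))

/-- The covariant derivative `(∇_W R)(X, Y) Z` of the curvature tensor, for `W, X, Y, Z ∈ T_x M`.
Here `X, Y, Z` are extended to the tangent fields `y ↦ P(y) X`, `P(y) Y`, `P(y) Z` on `M`, all of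
whose covariant derivatives vanish at `x` because `P (∂_W P) P = 0`. -/
def curvatureDeriv {q : ℕ} (M : Set (EuclideanSpace ℝ (Fin q)))
    (x W X Y Z : EuclideanSpace ℝ (Fin q)) : EuclideanSpace ℝ (Fin q) :=
  tangentProj M x (fderivWithin ℝ (fun y => curvature M y X Y Z) M x W)

/-- `W^{2,2}(S^1, ℝ^q)` with `S^1 = ℝ / 2πℤ`, each class being identified with its `C^1`
representative: a `2π`-periodic `C^1` function whose derivative is an indefinite integral of a
square-integrable function. -/
structure IsW22 {q : ℕ} (f : ℝ → EuclideanSpace ℝ (Fin q)) : Prop where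
  periodic : Function.Periodic f (2 * π)
  contDiff : ContDiff ℝ 1 f
  exists_second_deriv : ∃ g : ℝ → EuclideanSpace ℝ (Fin q),
    MemLp g 2 (volume.restrict (Ioc 0 (2 * π))) ∧
      ∀ t ∈ Icc (0 : ℝ) (2 * π), deriv f t = deriv f 0 + ∫ s in (0 : ℝ)..t, g s

/-- The square of the `W^{2,2}(S^1, ℝ^q)` norm. -/
def w22NormSq {q : ℕ} (f : ℝ → EuclideanSpace ℝ (Fin q)) : ℝ :=
  ∫ t in (0 : ℝ)..(2 * π), (‖f t‖ ^ 2 + ‖deriv f t‖ ^ 2 + ‖deriv (deriv f) t‖ ^ 2)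

/-- The space `W_ι^{2,2}(S^1, M)` of Sobolev immersions. -/
structure IsImmersion {q : ℕ} (M : Set (EuclideanSpace ℝ (Fin q)))
    (u : ℝ → EuclideanSpace ℝ (Fin q)) : Prop where
  isW22 : IsW22 u
  mem : ∀ t, u t ∈ M
  deriv_ne_zero : ∀ t, deriv u t ≠ 0

theorem IsW22.zero {q : ℕ} : IsW22 (0 : ℝ → EuclideanSpace ℝ (Fin q)) where
  periodic := fun _ => rfl
  contDiff := contDiff_const
  exists_second_deriv := ⟨0, MemLp.zero, fun t _ => by simp⟩

theorem IsW22.add {q : ℕ} {f g : ℝ → EuclideanSpace ℝ (Fin q)} (hf : IsW22 f) (hg : IsW22 g) :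
    IsW22 (f + g) where
  periodic := hf.periodic.add hg.periodic
  contDiff := hf.contDiff.add hg.contDiff
  exists_second_deriv := by
    obtain ⟨a, ha, ha'⟩ := hf.exists_second_deriv
    obtain ⟨b, hb, hb'⟩ := hg.exists_second_deriv
    have hd : ∀ t, deriv (f + g) t = deriv f t + deriv g t := fun t =>
      deriv_add (hf.contDiff.differentiable one_ne_zero t)
        (hg.contDiff.differentiable one_ne_zero t)
    refine ⟨a + b, ha.add hb, fun t ht => ?_⟩
    have hi : ∀ c : ℝ → EuclideanSpace ℝ (Fin q),
        MemLp c 2 (volume.restrict (Ioc 0 (2 * π))) → IntervalIntegrable c volume 0 t := by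
      intro c hc
      rw [intervalIntegrable_iff_integrableOn_Ioc_of_le ht.1]
      exact IntegrableOn.mono_set (hc.integrable one_le_two) (Ioc_subset_Ioc_right ht.2)
    rw [hd, hd, ha' t ht, hb' t ht]
    simp only [Pi.add_apply]
    rw [intervalIntegral.integral_add (hi a ha) (hi b hb)]
    abel

theorem IsW22.smul {q : ℕ} {f : ℝ → EuclideanSpace ℝ (Fin q)} (c : ℝ) (hf : IsW22 f) :
    IsW22 (c • f) where
  periodic := hf.periodic.smul c
  contDiff := contDiff_const.smul hf.contDiff
  exists_second_deriv := by
    obtain ⟨a, ha, ha'⟩ := hf.exists_second_deriv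
    have hd : ∀ t, deriv (c • f) t = c • deriv f t := fun t =>
      deriv_const_smul c (hf.contDiff.differentiable one_ne_zero t)
    refine ⟨c • a, ha.const_smul c, fun t ht => ?_⟩
    rw [hd, hd, ha' t ht]
    simp only [Pi.smul_apply]
    rw [intervalIntegral.integral_smul, smul_add]

/-- The vector space `W_u^{2,2}(S^1, TM)` of tangent vector fields along `u`. -/
def fieldsAlong {q : ℕ} (M : Set (EuclideanSpace ℝ (Fin q)))
    (u : ℝ → EuclideanSpace ℝ (Fin q)) : Submodule ℝ (ℝ → EuclideanSpace ℝ (Fin q)) where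
  carrier := {v | IsW22 v ∧ ∀ t, v t ∈ tangentSpaceAt M (u t)}
  zero_mem' := ⟨IsW22.zero, fun _ => Submodule.zero_mem _⟩
  add_mem' := fun ha hb => ⟨ha.1.add hb.1, fun t => Submodule.add_mem _ (ha.2 t) (hb.2 t)⟩
  smul_mem' := fun c _ ha => ⟨ha.1.smul c, fun t => Submodule.smul_mem _ c (ha.2 t)⟩

/-- The covariant derivative `D_t w = ∇_{u̇/|u̇|} w` with respect to arc length, along the curve
`u`, of a tangent field `w` along `u`. -/
def covDeriv {q : ℕ} (M : Set (EuclideanSpace ℝ (Fin q)))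
    (u w : ℝ → EuclideanSpace ℝ (Fin q)) (t : ℝ) : EuclideanSpace ℝ (Fin q) :=
  ‖deriv u t‖⁻¹ • tangentProj M (u t) (deriv w t)

/-- The unit tangent vector `u̇/|u̇|`. -/
def unitTangent {q : ℕ} (u : ℝ → EuclideanSpace ℝ (Fin q)) (t : ℝ) : EuclideanSpace ℝ (Fin q) :=
  ‖deriv u t‖⁻¹ • deriv u t

/-- The geodesic curvature vector `∇_{u̇/|u̇|} (u̇/|u̇|)`; its norm is `κ(u)`. -/
def curvatureVector {q : ℕ} (M : Set (EuclideanSpace ℝ (Fin q)))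
    (u : ℝ → EuclideanSpace ℝ (Fin q)) : ℝ → EuclideanSpace ℝ (Fin q) :=
  covDeriv M u (unitTangent u)

/-- The geodesic curvature `κ(u)`. -/
def geodesicCurvature {q : ℕ} (M : Set (EuclideanSpace ℝ (Fin q)))
    (u : ℝ → EuclideanSpace ℝ (Fin q)) (t : ℝ) : ℝ :=
  ‖curvatureVector M u t‖

/-- The energy `E_σ(u) = ∫_{S^1} (1 + σ² κ(u)²) |u̇|`. -/
def energy {q : ℕ} (M : Set (EuclideanSpace ℝ (Fin q))) (σ : ℝ)
    (u : ℝ → EuclideanSpace ℝ (Fin q)) : ℝ :=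
  ∫ t in (0 : ℝ)..(2 * π), (1 + σ ^ 2 * geodesicCurvature M u t ^ 2) * ‖deriv u t‖

/-- `γ` is a curve in `W_ι^{2,2}(S^1, M)` through `u = γ(0)` which is differentiable at `0`, as a
curve in the Hilbert space `W^{2,2}(S^1, ℝ^q)`, with velocity `v`. -/
structure IsVariation {q : ℕ} (M : Set (EuclideanSpace ℝ (Fin q)))
    (u v : ℝ → EuclideanSpace ℝ (Fin q)) (γ : ℝ → ℝ → EuclideanSpace ℝ (Fin q)) : Prop where
  isImmersion : ∀ᶠ s in 𝓝 (0 : ℝ), IsImmersion M (γ s)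
  initial : γ 0 = u
  velocity : (fun s : ℝ => √(w22NormSq (γ s - u - s • v))) =o[𝓝 0] (fun s : ℝ => s)

/-- `u` is a critical point of `E_σ` on `W_ι^{2,2}(S^1, M)`: `DE_σ(u) · v = 0` for every
`v ∈ W_u^{2,2}(S^1, TM)`. -/
def IsCritical {q : ℕ} (M : Set (EuclideanSpace ℝ (Fin q))) (σ : ℝ)
    (u : ℝ → EuclideanSpace ℝ (Fin q)) : Prop :=
  IsImmersion M u ∧ ∀ v ∈ fieldsAlong M u, ∀ γ : ℝ → ℝ → EuclideanSpace ℝ (Fin q),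
    IsVariation M u v γ → HasDerivAt (fun s => energy M σ (γ s)) 0 0

/-- `u : S^1 → M` is a closed geodesic: an immersion with `D_t u̇ = 0`. It is non-trivial, since
`u̇` vanishes nowhere. -/
def IsClosedGeodesic {q : ℕ} (M : Set (EuclideanSpace ℝ (Fin q)))
    (u : ℝ → EuclideanSpace ℝ (Fin q)) : Prop :=
  IsImmersion M u ∧ ∀ᵐ t, covDeriv M u (deriv u) t = 0

/-- The `σ²`-part of the second variation: one half of the second derivative, at `s = 0`, of the
squared geodesic curvature along the geodesic variation of `u` in the direction `v`.
Below `T = u̇/|u̇|`, `K = D_t T`, `R` is the curvature tensor at `u(t)`. -/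
def curvatureSecondVariation {q : ℕ} (M : Set (EuclideanSpace ℝ (Fin q)))
    (u v : ℝ → EuclideanSpace ℝ (Fin q)) (t : ℝ) : ℝ :=
  let T := unitTangent u t
  let K := curvatureVector M u t
  let V := v t
  let DV := covDeriv M u v t
  let DDV := covDeriv M u (covDeriv M u v) t
  let R := curvature M (u t)
  let DR := curvatureDeriv M (u t)
  ‖DDV‖ ^ 2 + ‖R V T T‖ ^ 2
    + 2 * (4 * ⟪DV, T⟫_ℝ ^ 2 + 2 * ⟪DV, T⟫_ℝ ^ 2 - ‖DV‖ ^ 2 + ⟪R T V V, T⟫_ℝ) * ‖K‖ ^ 2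
    - (⟪DDV, T⟫_ℝ + ⟪DV, K⟫_ℝ) ^ 2 - 8 * ⟪DV, T⟫_ℝ * ⟪DDV, K⟫_ℝ
    + ⟪DR T V T V, K⟫_ℝ + ⟪DR V V T T, K⟫_ℝ
    + ⟪R DV T V, K⟫_ℝ - ⟪R K V V, K⟫_ℝ + 3 * ⟪R V T DV, K⟫_ℝ + ⟪R V DV T, K⟫_ℝ
    + 2 * ⟪R V T T, DDV⟫_ℝ - 8 * ⟪DV, T⟫_ℝ * ⟪R V T T, K⟫_ℝ

/-- The second variation `D²E_σ(u)[v, v]` of `E_σ` at a critical point `u`, in the direction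
`v ∈ W_u^{2,2}(S^1, TM)`; the integrals over `S^1` are with respect to arc length `|u̇| dt`. -/
def secondVariation {q : ℕ} (M : Set (EuclideanSpace ℝ (Fin q))) (σ : ℝ)
    (u v : ℝ → EuclideanSpace ℝ (Fin q)) : ℝ :=
  2 * σ ^ 2 * (∫ t in (0 : ℝ)..(2 * π), curvatureSecondVariation M u v t * ‖deriv u t‖)
    + 4 * σ ^ 2 * (∫ t in (0 : ℝ)..(2 * π),
        ⟪covDeriv M u v t, unitTangent u t⟫_ℝ *
          (⟪covDeriv M u (covDeriv M u v) t, curvatureVector M u t⟫_ℝ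
            - 2 * ⟪covDeriv M u v t, unitTangent u t⟫_ℝ * geodesicCurvature M u t ^ 2
            + ⟪curvature M (u t) (v t) (unitTangent u t) (unitTangent u t),
                curvatureVector M u t⟫_ℝ) * ‖deriv u t‖)
    + ∫ t in (0 : ℝ)..(2 * π),
        (1 + σ ^ 2 * geodesicCurvature M u t ^ 2) *
          (‖covDeriv M u v t‖ ^ 2 - ⟪covDeriv M u v t, unitTangent u t⟫_ℝ ^ 2
            - ⟪curvature M (u t) (unitTangent u t) (v t) (v t), unitTangent u t⟫_ℝ)
          * ‖deriv u t‖

/-- `D²E_σ(u)` is negative definite on the linear subspace `V` of `W_u^{2,2}(S^1, TM)`. -/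
def IsNegDefOn {q : ℕ} (M : Set (EuclideanSpace ℝ (Fin q))) (σ : ℝ)
    (u : ℝ → EuclideanSpace ℝ (Fin q)) (V : Submodule ℝ (ℝ → EuclideanSpace ℝ (Fin q))) : Prop :=
  V ≤ fieldsAlong M u ∧ ∀ v ∈ V, v ≠ 0 → secondVariation M σ u v < 0

/-- The index `Ind(u) ∈ ℕ ∪ {∞}` of a critical point `u` of `E_σ`: the largest dimension of a linear
subspace of `W_u^{2,2}(S^1, TM)` on which `D²E_σ(u)` is negative definite. -/
def index {q : ℕ} (M : Set (EuclideanSpace ℝ (Fin q))) (σ : ℝ)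
    (u : ℝ → EuclideanSpace ℝ (Fin q)) : ℕ∞ :=
  ⨆ V : {V : Submodule ℝ (ℝ → EuclideanSpace ℝ (Fin q)) // IsNegDefOn M σ u V},
    Cardinal.toENat (Module.rank ℝ V.1)

end ViscosityGeodesic

end

/-! The index is lower semicontinuous because negative directions of the limit can be transplanted
to the approximating curves. Given finitely many independent fields along `u₀` spanning a space on
which the second variation of length is negative definite, each combination `v` is projected onto
the tangent spaces along `u n`. The claim is that the second variation of `E_σ` at `u n` in the
projected direction converges to that of length at `u₀` in the direction `v`. Compactness of the
unit sphere of coefficients then makes negativity hold for all combinations at once when `n` is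
large, and homogeneity turns this into a negative definite space of the same dimension.

The convergence has two ingredients. The length part of the form involves only `u`, `u'`, `v`, `v'`,
so bounded speeds and almost everywhere convergence of `u'` suffice for dominated convergence
(`tendsto_lengthSecondVariation`). Everything else carries a factor `σ²`, and its integrand grows at
most quadratically in the curvature vector and in `v''`: the second covariant derivative of the
projected field is at most `C (1 + κ + |v''|)` (`exists_norm_covDeriv_covDeriv_le`). Hence the
remainder is bounded by `σ²` times a constant plus a multiple of `σ² ∫ κ²`, and tends to zero
(`exists_abs_secondVariation_sub_le`).

To differentiate and estimate, the tangential projection of `M` is extended to a `C²` map `A` on the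
whole of `ℝ^q` (`exists_contDiff_extension_tangentProj`); projecting `v` along `u n` is then `t ↦ A
(u n t) (v t)`, and the curvature tensor and its derivative become explicit continuous expressions
in `A`. The final assembly is `eventually_secondVariation_neg` together with `natCast_le_index`. -/

noncomputable section

namespace ViscosityGeodesic

/-! ### Orthogonal projections onto images of a fixed subspace, depending smoothly on the operator.
-/

section RangeProjection

variable {E : Type*} [NormedAddCommGroup E] [InnerProductSpace ℝ E] [FiniteDimensional ℝ E]

/-- The Gram operator of `B ∘ π_V`, completed by the identity on the orthogonal complement of `V`. -/
def gramOperator (V : Submodule ℝ E) (B : E →L[ℝ] E) : E →L[ℝ] E :=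
  star (B * V.starProjection) * (B * V.starProjection) + (1 - V.starProjection)

/-- A formula for the orthogonal projection onto `B(V)`, depending smoothly on `B`. -/
def imageProjection (V : Submodule ℝ E) (B : E →L[ℝ] E) : E →L[ℝ] E :=
  (B * V.starProjection) * Ring.inverse (gramOperator V B) * star (B * V.starProjection)

/-- With `p` the projection onto `V` and `N` the Gram operator, `⟪N x, x⟫ = ‖B (p x)‖² + ‖x - p
x‖²`. If `N x = 0`, both squares vanish; injectivity of `B` gives `p x = 0`, and then `x = 0`. -/
theorem isUnit_gramOperator (V : Submodule ℝ E) {B : E →L[ℝ] E} (hB : Function.Injective B) :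
    IsUnit (gramOperator V B) := by
  rw [ContinuousLinearMap.isUnit_iff_isUnit_toLinearMap, LinearMap.isUnit_iff_ker_eq_bot,
    LinearMap.ker_eq_bot']
  intro x hx
  have hx' : gramOperator V B x = 0 := hx
  have h1 : ⟪gramOperator V B x, x⟫_ℝ =
      ‖B (V.starProjection x)‖ ^ 2 + ‖x - V.starProjection x‖ ^ 2 := by
    have h2 : ⟪star (B * V.starProjection) ((B * V.starProjection) x), x⟫_ℝ =
        ‖B (V.starProjection x)‖ ^ 2 := by
      rw [ContinuousLinearMap.star_eq_adjoint, ContinuousLinearMap.adjoint_inner_left,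
        real_inner_self_eq_norm_sq]
      rfl
    have h3 : ⟪x - V.starProjection x, V.starProjection x⟫_ℝ = 0 :=
      Submodule.inner_left_of_mem_orthogonal (Submodule.starProjection_apply_mem _ _)
        (Submodule.sub_starProjection_mem_orthogonal x)
    have h4 : ⟪x - V.starProjection x, x⟫_ℝ = ‖x - V.starProjection x‖ ^ 2 := by
      rw [← real_inner_self_eq_norm_sq]
      conv_rhs => rw [inner_sub_right, h3, sub_zero]
    rw [← h2, ← h4, ← inner_add_left]
    rfl
  rw [hx', inner_zero_left] at h1
  have h2 : ‖B (V.starProjection x)‖ = 0 := by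
    nlinarith [sq_nonneg ‖B (V.starProjection x)‖, sq_nonneg ‖x - V.starProjection x‖]
  have h3 : ‖x - V.starProjection x‖ = 0 := by
    nlinarith [sq_nonneg ‖B (V.starProjection x)‖, sq_nonneg ‖x - V.starProjection x‖]
  rw [norm_eq_zero] at h2 h3
  have h4 : V.starProjection x = 0 := hB (by rw [h2, map_zero])
  rwa [h4, sub_zero] at h3

/-- Write `S = B p` and `P = S N⁻¹ S*`. Since `N p = S* S`, one gets `P S = S`. As `N`, hence `P`,
is self-adjoint, `⟪P x, S v⟫ = ⟪x, S v⟫`, so `x - P x` is orthogonal to the image, which contains `P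
x`. -/
theorem imageProjection_eq (V : Submodule ℝ E) {B : E →L[ℝ] E} (hB : Function.Injective B) :
    imageProjection V B = (V.map B.toLinearMap).starProjection := by
  have hu := isUnit_gramOperator V hB
  set p := V.starProjection with hp
  have hpp : p * p = p := V.isIdempotentElem_starProjection
  have hps : star p = p := isSelfAdjoint_starProjection V
  set S := B * p with hS
  set N := gramOperator V B with hN
  have hNdef : N = star S * S + (1 - p) := rfl
  have hSp : S * p = S := by rw [hS, mul_assoc, hpp]
  have hNp : N * p = star S * S := by
    rw [hNdef, add_mul, mul_assoc, hSp, sub_mul, hpp, one_mul, sub_self, add_zero]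
  have hPS : imageProjection V B * S = S := by
    change S * Ring.inverse N * star S * S = S
    rw [mul_assoc, ← hNp, mul_assoc, ← mul_assoc (Ring.inverse N), Ring.inverse_mul_cancel N hu,
      one_mul, hSp]
  ext1 x
  refine Submodule.eq_starProjection_of_mem_of_inner_eq_zero ?_ ?_ |>.symm
  · refine ⟨p ((Ring.inverse N * star S) x), Submodule.starProjection_apply_mem _ _, ?_⟩
    rfl
  · rintro _ ⟨v, hv, rfl⟩
    have h1 : B v = S v := by
      change B v = B (p v)
      rw [hp, Submodule.starProjection_eq_self_iff.mpr hv]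
    have hsN : star N = N := by
      rw [hNdef]
      simp [hps]
    have hsI : star (Ring.inverse N) = Ring.inverse N := by
      rw [← Ring.inverse_star, hsN]
    have hsP : star (imageProjection V B) = imageProjection V B := by
      change star (S * Ring.inverse N * star S) = S * Ring.inverse N * star S
      rw [star_mul, star_mul S, star_star, hsI]
      exact (mul_assoc S _ _).symm
    change ⟪x - imageProjection V B x, B v⟫_ℝ = 0
    have h2 : ⟪imageProjection V B x, S v⟫_ℝ = ⟪x, (imageProjection V B * S) v⟫_ℝ := by
      conv_lhs => rw [← hsP, ContinuousLinearMap.star_eq_adjoint,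
        ContinuousLinearMap.adjoint_inner_left]
      rfl
    rw [h1, inner_sub_left, h2, hPS, sub_self]

theorem contDiffOn_imageProjection {F : Type*} [NormedAddCommGroup F] [NormedSpace ℝ F]
    {n : WithTop ℕ∞} (V : Submodule ℝ E) {D : F → E →L[ℝ] E} {s : Set F} (hD : ContDiffOn ℝ n D s)
    (hinj : ∀ x ∈ s, Function.Injective (D x)) :
    ContDiffOn ℝ n (fun x => imageProjection V (D x)) s := by
  have h1 : ContDiffOn ℝ n (fun x => D x * V.starProjection) s := hD.mul contDiffOn_const
  have h2 : ContDiffOn ℝ n (fun x => star (D x * V.starProjection)) s :=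
    (starL' ℝ : (E →L[ℝ] E) ≃L[ℝ] (E →L[ℝ] E)).contDiff.comp_contDiffOn h1
  have h3 : ContDiffOn ℝ n (fun x => gramOperator V (D x)) s :=
    (h2.mul h1).add contDiffOn_const
  have h4 : ContDiffOn ℝ n (fun x => Ring.inverse (gramOperator V (D x))) s := by
    intro x hx
    obtain ⟨N, hN⟩ := isUnit_gramOperator V (hinj x hx)
    have := contDiffAt_ringInverse ℝ (n := n) N
    rw [hN] at this
    exact this.comp_contDiffWithinAt x (h3 x hx)
  exact (h1.mul h4).mul h2

end RangeProjection

/-! ### Tangent spaces in flattening charts and a `C²` extension of the tangential projection. -/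

variable {q : ℕ}

local notation "𝔼" q => EuclideanSpace ℝ (Fin q)

theorem fderiv_symm_comp_fderiv {Φ : OpenPartialHomeomorph (𝔼 q) (𝔼 q)} {y : 𝔼 q}
    (hy : y ∈ Φ.source) {C D : (𝔼 q) →L[ℝ] (𝔼 q)} (hC : HasFDerivAt Φ C y)
    (hD : HasFDerivAt Φ.symm D (Φ y)) (z : 𝔼 q) : D (C z) = z := by
  have h1 : HasFDerivAt (Φ.symm ∘ Φ) (D ∘L C) y := HasFDerivAt.comp _ hD hC
  refine DFunLike.congr_fun (h1.unique ((hasFDerivAt_id _).congr_of_eventuallyEq ?_)) z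
  filter_upwards [Φ.open_source.mem_nhds hy] with z hz
  exact Φ.left_inv hz

theorem injective_fderiv_symm {Φ : OpenPartialHomeomorph (𝔼 q) (𝔼 q)} {y : 𝔼 q}
    (hy : y ∈ Φ.source) {C D : (𝔼 q) →L[ℝ] (𝔼 q)} (hC : HasFDerivAt Φ C y)
    (hD : HasFDerivAt Φ.symm D (Φ y)) : Function.Injective D := by
  have h := fderiv_symm_comp_fderiv (Φ := Φ.symm) (Φ.map_source hy) hD
    (by rwa [Φ.left_inv hy] : HasFDerivAt Φ C (Φ.symm (Φ y)))
  intro a b hab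
  rw [← h a, hab, h b]

/-- For one inclusion, the component of `Φ` orthogonal to `V` vanishes on `M`, so its derivative
kills the tangent cone. For the other, segments in `V` through `Φ y` put every `v ∈ V` in the
tangent cone of the flattened set, and the derivative of `Φ.symm` carries it to the tangent cone of
`M`. -/
theorem tangentSpaceAt_eq_map {M : Set (𝔼 q)} {Φ : OpenPartialHomeomorph (𝔼 q) (𝔼 q)}
    {V : Submodule ℝ (𝔼 q)} (hV : ∀ y ∈ Φ.source, y ∈ M ↔ Φ y ∈ V) {y : 𝔼 q}
    (hy : y ∈ Φ.source) (hyM : y ∈ M) {C D : (𝔼 q) →L[ℝ] (𝔼 q)} (hC : HasFDerivAt Φ C y)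
    (hD : HasFDerivAt Φ.symm D (Φ y)) :
    tangentSpaceAt M y = V.map D.toLinearMap := by
  refine le_antisymm ?_ ?_
  · refine Submodule.span_le.mpr fun w hw => ?_
    rw [← tangentConeAt_inter_nhds (Φ.open_source.mem_nhds hy)] at hw
    set g : (𝔼 q) →L[ℝ] (𝔼 q) := 1 - V.starProjection
    have hg : ∀ z ∈ V, g z = 0 := fun z hz => by
      change z - V.starProjection z = 0
      rw [Submodule.starProjection_eq_self_iff.mpr hz, sub_self]
    have h1 : HasFDerivWithinAt (g ∘ Φ) (g ∘L C) (M ∩ Φ.source) y :=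
      (g.hasFDerivAt.comp y hC).hasFDerivWithinAt
    have h2 : HasFDerivWithinAt (g ∘ Φ) (0 : (𝔼 q) →L[ℝ] (𝔼 q)) (M ∩ Φ.source) y :=
      (hasFDerivWithinAt_const (0 : 𝔼 q) y _).congr
        (fun z hz => hg _ ((hV z hz.2).mp hz.1)) (hg _ ((hV y hy).mp hyM))
    have h3 : C w - V.starProjection (C w) = 0 := h1.unique_on h2 hw
    refine ⟨C w, ?_, fderiv_symm_comp_fderiv hy hC hD w⟩
    rw [SetLike.mem_coe, ← Submodule.starProjection_eq_self_iff]
    exact (sub_eq_zero.mp h3).symm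
  · rintro _ ⟨v, hv, rfl⟩
    refine Submodule.subset_span ?_
    have hVy : Φ y ∈ V := (hV y hy).mp hyM
    have h1 : v ∈ tangentConeAt ℝ ((V : Set (𝔼 q)) ∩ Φ.target) (Φ y) := by
      rw [tangentConeAt_inter_nhds (Φ.open_target.mem_nhds (Φ.map_source hy))]
      have := mem_tangentConeAt_of_segment_subset
        (V.convex.segment_subset hVy (V.add_mem hVy hv))
      simpa using this
    have h2 := hD.hasFDerivWithinAt.mapsTo_tangent_cone h1
    rw [Φ.left_inv hy] at h2
    refine tangentConeAt_mono ?_ h2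
    rintro _ ⟨z, ⟨hz1, hz2⟩, rfl⟩
    rw [hV _ (Φ.map_target hz2), Φ.right_inv hz2]
    exact hz1

/-- The tangential projection of a closed `C^3` submanifold extends to a `C^2` map. -/
theorem exists_contDiff_extension_tangentProj {M : Set (𝔼 q)} {ν : ℕ∞} {m : ℕ} (hν : 3 ≤ ν)
    (hM : IsClosed M) (hMν : IsSubmanifold ν m M) :
    ∃ A : (𝔼 q) → (𝔼 q) →L[ℝ] (𝔼 q), ContDiff ℝ 2 A ∧ ∀ x ∈ M, A x = tangentProj M x := by
  -- The admissible values form a singleton on `M` and the whole space off `M`. They are convex in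
  -- both cases, so local solutions can be glued by a partition of unity.
  let t : (𝔼 q) → Set ((𝔼 q) →L[ℝ] (𝔼 q)) := fun x => {L | x ∈ M → L = tangentProj M x}
  suffices h : ∀ x, ∃ U ∈ 𝓝 x, ∃ g : (𝔼 q) → (𝔼 q) →L[ℝ] (𝔼 q),
      ContDiffOn ℝ 2 g U ∧ ∀ y ∈ U, g y ∈ t y by
    have hconv : ∀ x, Convex ℝ (t x) := by
      intro x a ha b hb s t _ _ hst hx
      rw [ha hx, hb hx]
      exact Convex.combo_self hst _
    obtain ⟨A, hA⟩ := exists_contMDiffMap_forall_mem_convex_of_local (n := (2 : ℕ∞))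
      (modelWithCornersSelf ℝ (𝔼 q)) hconv fun x => by
        obtain ⟨U, hU, g, hg, hgt⟩ := h x
        exact ⟨U, hU, g, hg.contMDiffOn, hgt⟩
    exact ⟨A, A.contMDiff.contDiff, hA⟩
  intro x
  by_cases hx : x ∈ M
  · obtain ⟨Φ, hxs, h1, h2, V, -, hV⟩ := hMν x hx
    have h3 : (3 : WithTop ℕ∞) ≤ (ν : WithTop ℕ∞) := WithTop.coe_le_coe.mpr hν
    have hd : ∀ y ∈ Φ.source, HasFDerivAt Φ (fderiv ℝ Φ y) y := fun y hy =>
      ((h1.contDiffAt (Φ.open_source.mem_nhds hy)).differentiableAt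
        (fun h0 => by rw [h0] at h3; simp at h3)).hasFDerivAt
    have hd' : ∀ y ∈ Φ.source, HasFDerivAt Φ.symm (fderiv ℝ Φ.symm (Φ y)) (Φ y) := fun y hy =>
      ((h2.contDiffAt (Φ.open_target.mem_nhds (Φ.map_source hy))).differentiableAt
        (fun h0 => by rw [h0] at h3; simp at h3)).hasFDerivAt
    -- One derivative is spent on the differential of the chart: this is how `C³` charts produce a
    -- `C²` projection.
    have hD : ContDiffOn ℝ 2 (fun y => fderiv ℝ Φ.symm (Φ y)) Φ.source := by
      have h4 : ContDiffOn ℝ 2 (fderiv ℝ Φ.symm) Φ.target :=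
        h2.fderiv_of_isOpen Φ.open_target (le_trans (by norm_num) h3)
      exact h4.comp (h1.of_le (le_trans (by norm_num) h3)) fun y hy => Φ.map_source hy
    have hinj : ∀ y ∈ Φ.source, Function.Injective (fderiv ℝ Φ.symm (Φ y)) := fun y hy =>
      injective_fderiv_symm hy (hd y hy) (hd' y hy)
    refine ⟨Φ.source, Φ.open_source.mem_nhds hxs,
      fun y => imageProjection V (fderiv ℝ Φ.symm (Φ y)), ?_, ?_⟩
    · exact contDiffOn_imageProjection V hD hinj
    · intro y hy hyM
      simp only [imageProjection_eq V (hinj y hy), tangentProj,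
        tangentSpaceAt_eq_map hV hy hyM (hd y hy) (hd' y hy)]
  · refine ⟨Mᶜ, hM.isOpen_compl.mem_nhds hx, fun _ => 0, contDiffOn_const, ?_⟩
    intro y hy hyM
    exact absurd hyM hy

/-! ### The curvature tensor and its covariant derivative through the extension `A`. -/

theorem tangentProj_apply_mem (M : Set (𝔼 q)) (x X : 𝔼 q) :
    tangentProj M x X ∈ tangentSpaceAt M x :=
  Submodule.starProjection_apply_mem _ _

theorem tangentProj_apply_of_mem {M : Set (𝔼 q)} {x X : 𝔼 q} (hX : X ∈ tangentSpaceAt M x) :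
    tangentProj M x X = X :=
  Submodule.starProjection_eq_self_iff.mpr hX

theorem norm_tangentProj_apply_le (M : Set (𝔼 q)) (x X : 𝔼 q) : ‖tangentProj M x X‖ ≤ ‖X‖ :=
  Submodule.norm_starProjection_apply_le _ _

/-- Derivatives within `M` are not unique as linear maps on `ℝ^q`, but any two agree on the tangent
cone, hence on its span. On tangent vectors the derivative of any extension may therefore be used.
-/
theorem fderivWithin_apply_of_mem_tangentSpaceAt {F : Type*} [NormedAddCommGroup F]
    [NormedSpace ℝ F] {M : Set (𝔼 q)} {f g : (𝔼 q) → F} {g' : (𝔼 q) →L[ℝ] F} {x X : 𝔼 q}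
    (hfg : ∀ y ∈ M, f y = g y) (hx : x ∈ M) (hg : HasFDerivAt g g' x)
    (hX : X ∈ tangentSpaceAt M x) : fderivWithin ℝ f M x X = g' X := by
  have h1 : HasFDerivWithinAt f g' M x := hg.hasFDerivWithinAt.congr hfg (hfg x hx)
  have h2 := h1.differentiableWithinAt.hasFDerivWithinAt
  have h3 : tangentSpaceAt M x ≤ LinearMap.eqLocus (fderivWithin ℝ f M x).toLinearMap g'.toLinearMap :=
    Submodule.span_le.mpr fun w hw => h2.unique_on h1 hw
  exact h3 hX

/-- The formula for the curvature tensor in terms of an extension `A` of the tangential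
projection. -/
def curvExt (A : (𝔼 q) → (𝔼 q) →L[ℝ] (𝔼 q)) (x X Y Z : 𝔼 q) : 𝔼 q :=
  A x (fderiv ℝ A x (A x X) (fderiv ℝ A x (A x Y) (A x Z))
    - fderiv ℝ A x (A x Y) (fderiv ℝ A x (A x X) (A x Z)))

/-- The formula for the covariant derivative of the curvature tensor in terms of an extension `A` of
the tangential projection. -/
def curvDerivExt (A : (𝔼 q) → (𝔼 q) →L[ℝ] (𝔼 q)) (x W X Y Z : 𝔼 q) : 𝔼 q :=
  A x (fderiv ℝ (fun y => curvExt A y X Y Z) x W)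

section

variable {A : (𝔼 q) → (𝔼 q) →L[ℝ] (𝔼 q)}

theorem contDiff_fderiv_apply (hA : ContDiff ℝ 2 A) {F : Type*} [NormedAddCommGroup F]
    [NormedSpace ℝ F] {f g h : F → 𝔼 q} (hf : ContDiff ℝ 1 f) (hg : ContDiff ℝ 1 g)
    (hh : ContDiff ℝ 1 h) : ContDiff ℝ 1 (fun p => fderiv ℝ A (f p) (g p) (h p)) :=
  ((((hA.fderiv_right (m := 1) (by norm_num)).comp hf).clm_apply hg).clm_apply hh)

theorem contDiff_apply (hA : ContDiff ℝ 2 A) {F : Type*} [NormedAddCommGroup F]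
    [NormedSpace ℝ F] {f g : F → 𝔼 q} (hf : ContDiff ℝ 1 f) (hg : ContDiff ℝ 1 g) :
    ContDiff ℝ 1 (fun p => A (f p) (g p)) :=
  ((hA.of_le (by norm_num)).comp hf).clm_apply hg

theorem contDiff_curvExt (hA : ContDiff ℝ 2 A) {F : Type*} [NormedAddCommGroup F]
    [NormedSpace ℝ F] {f X Y Z : F → 𝔼 q} (hf : ContDiff ℝ 1 f) (hX : ContDiff ℝ 1 X)
    (hY : ContDiff ℝ 1 Y) (hZ : ContDiff ℝ 1 Z) :
    ContDiff ℝ 1 (fun p => curvExt A (f p) (X p) (Y p) (Z p)) := by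
  have hX' := contDiff_apply hA hf hX
  have hY' := contDiff_apply hA hf hY
  have hZ' := contDiff_apply hA hf hZ
  exact contDiff_apply hA hf
    ((contDiff_fderiv_apply hA hf hX' (contDiff_fderiv_apply hA hf hY' hZ')).sub
      (contDiff_fderiv_apply hA hf hY' (contDiff_fderiv_apply hA hf hX' hZ')))

/-- The expression `curvExt` contains one derivative of `A` and is `C¹` jointly in the point and its
three arguments; the remaining derivative costs exactly the second order of smoothness of `A`. -/
theorem continuous_curvDerivExt (hA : ContDiff ℝ 2 A) :
    Continuous (fun p : (𝔼 q) × (𝔼 q) × (𝔼 q) × (𝔼 q) × (𝔼 q) =>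
      curvDerivExt A p.1 p.2.1 p.2.2.1 p.2.2.2.1 p.2.2.2.2) := by
  have h1 : ContDiff ℝ 0 (fun p : (𝔼 q) × (𝔼 q) × (𝔼 q) × (𝔼 q) × (𝔼 q) =>
      fderiv ℝ (fun y => curvExt A y p.2.2.1 p.2.2.2.1 p.2.2.2.2) p.1) := by
    refine ContDiff.fderiv (m := 1) ?_ contDiff_fst (by norm_num)
    exact contDiff_curvExt hA contDiff_snd (by fun_prop) (by fun_prop) (by fun_prop)
  exact (hA.continuous.comp continuous_fst).clm_apply
    (h1.continuous.clm_apply (by fun_prop))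

theorem curvExt_smul (x X Y Z : 𝔼 q) (a b c : ℝ) :
    curvExt A x (a • X) (b • Y) (c • Z) = (a * b * c) • curvExt A x X Y Z := by
  have h : ∀ (X Y Z : 𝔼 q) (a b c : ℝ),
      fderiv ℝ A x (A x (a • X)) (fderiv ℝ A x (A x (b • Y)) (A x (c • Z))) =
        (a * b * c) • fderiv ℝ A x (A x X) (fderiv ℝ A x (A x Y) (A x Z)) := by
    intro X Y Z a b c
    rw [(A x).map_smul, (A x).map_smul, (A x).map_smul, (fderiv ℝ A x).map_smul,
      (fderiv ℝ A x).map_smul, smul_apply, smul_apply, ContinuousLinearMap.map_smul,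
      ContinuousLinearMap.map_smul, ContinuousLinearMap.map_smul, smul_smul, smul_smul,
      mul_assoc]
  rw [curvExt, h, h, mul_comm b a, ← smul_sub, (A x).map_smul, curvExt]

theorem curvDerivExt_smul (hA : ContDiff ℝ 2 A) (x W X Y Z : 𝔼 q) (d a b c : ℝ) :
    curvDerivExt A x (d • W) (a • X) (b • Y) (c • Z) =
      (d * a * b * c) • curvDerivExt A x W X Y Z := by
  have h1 : DifferentiableAt ℝ (fun y => curvExt A y X Y Z) x :=
    (contDiff_curvExt hA contDiff_id contDiff_const contDiff_const
      contDiff_const).differentiable one_ne_zero x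
  simp only [curvDerivExt, curvExt_smul]
  rw [fderiv_fun_const_smul h1, smul_apply, map_smul, map_smul, map_smul,
    smul_smul]
  congr 1
  ring

variable {M : Set (𝔼 q)}

theorem tangentProjDeriv_eq (hA : ContDiff ℝ 2 A) (hAM : ∀ x ∈ M, A x = tangentProj M x)
    {x X : 𝔼 q} (hx : x ∈ M) (hX : X ∈ tangentSpaceAt M x) :
    tangentProjDeriv M x X = fderiv ℝ A x X :=
  fderivWithin_apply_of_mem_tangentSpaceAt (fun y hy => (hAM y hy).symm) hx
    (hA.differentiable (by norm_num) x).hasFDerivAt hX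

theorem curvature_eq_curvExt (hA : ContDiff ℝ 2 A) (hAM : ∀ x ∈ M, A x = tangentProj M x)
    {x : 𝔼 q} (hx : x ∈ M) (X Y Z : 𝔼 q) : curvature M x X Y Z = curvExt A x X Y Z := by
  rw [curvature, curvExt, hAM x hx,
    tangentProjDeriv_eq hA hAM hx (tangentProj_apply_mem M x X),
    tangentProjDeriv_eq hA hAM hx (tangentProj_apply_mem M x Y)]

theorem curvatureDeriv_eq_curvDerivExt (hA : ContDiff ℝ 2 A)
    (hAM : ∀ x ∈ M, A x = tangentProj M x) {x W : 𝔼 q} (hx : x ∈ M)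
    (hW : W ∈ tangentSpaceAt M x) (X Y Z : 𝔼 q) :
    curvatureDeriv M x W X Y Z = curvDerivExt A x W X Y Z := by
  have h1 : DifferentiableAt ℝ (fun y => curvExt A y X Y Z) x :=
    (contDiff_curvExt hA contDiff_id contDiff_const contDiff_const
      contDiff_const).differentiable one_ne_zero x
  rw [curvatureDeriv, curvDerivExt, hAM x hx,
    fderivWithin_apply_of_mem_tangentSpaceAt
      (fun y hy => curvature_eq_curvExt hA hAM hy X Y Z) hx h1.hasFDerivAt hW]

theorem exists_norm_curvature_le (hM : IsCompact M) (hA : ContDiff ℝ 2 A)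
    (hAM : ∀ x ∈ M, A x = tangentProj M x) :
    ∃ C, 0 ≤ C ∧ ∀ x ∈ M, ∀ X Y Z, ‖curvature M x X Y Z‖ ≤ C * ‖X‖ * ‖Y‖ * ‖Z‖ := by
  obtain ⟨C, hC⟩ := hM.exists_bound_of_continuousOn
    (hA.continuous_fderiv (by norm_num)).continuousOn
  refine ⟨2 * C ^ 2, by positivity, fun x hx X Y Z => ?_⟩
  have hC0 : 0 ≤ C := (norm_nonneg _).trans (hC x hx)
  have h1 : ∀ X Y Z, ‖fderiv ℝ A x (tangentProj M x X) (fderiv ℝ A x (tangentProj M x Y)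
      (tangentProj M x Z))‖ ≤ C * ‖X‖ * (C * ‖Y‖ * ‖Z‖) := by
    intro X Y Z
    have h2 : ∀ X Z, ‖fderiv ℝ A x (tangentProj M x X) Z‖ ≤ C * ‖X‖ * ‖Z‖ := by
      intro X Z
      refine (ContinuousLinearMap.le_opNorm _ _).trans ?_
      gcongr
      refine (ContinuousLinearMap.le_opNorm _ _).trans ?_
      gcongr
      · exact hC x hx
      · exact norm_tangentProj_apply_le M x X
    refine (h2 X _).trans ?_
    gcongr
    refine (h2 Y _).trans ?_
    gcongr
    exact norm_tangentProj_apply_le M x Z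
  rw [curvature_eq_curvExt hA hAM hx, curvExt, hAM x hx]
  refine (norm_tangentProj_apply_le M x _).trans ((norm_sub_le _ _).trans ?_)
  refine (add_le_add (h1 X Y Z) (h1 Y X Z)).trans (le_of_eq ?_)
  ring

/-- A bound on balls is enough here, because the arguments to be inserted are the unit tangent and
the field itself. It follows from continuity on a compact set, without any multilinear estimate. -/
theorem exists_norm_curvatureDeriv_le (hM : IsCompact M) (hA : ContDiff ℝ 2 A)
    (hAM : ∀ x ∈ M, A x = tangentProj M x) (r : ℝ) :
    ∃ C, 0 ≤ C ∧ ∀ x ∈ M, ∀ W ∈ tangentSpaceAt M x, ∀ X Y Z, ‖W‖ ≤ r → ‖X‖ ≤ r → ‖Y‖ ≤ r →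
      ‖Z‖ ≤ r → ‖curvatureDeriv M x W X Y Z‖ ≤ C := by
  have hB : IsCompact (Metric.closedBall (0 : 𝔼 q) r) := isCompact_closedBall _ _
  obtain ⟨C, hC⟩ := (hM.prod (hB.prod (hB.prod (hB.prod hB)))).exists_bound_of_continuousOn
    (continuous_curvDerivExt hA).continuousOn
  refine ⟨max C 0, le_max_right _ _, fun x hx W hW X Y Z h1 h2 h3 h4 => ?_⟩
  rw [curvatureDeriv_eq_curvDerivExt hA hAM hx hW]
  refine (hC (x, W, X, Y, Z) ?_).trans (le_max_left _ _)
  simp [hx, h1, h2, h3, h4]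

end

/-! ### Absolutely continuous functions and `W^{2,2}` calculus on the circle. -/

/-- Lebesgue measure on a fundamental domain of the circle `ℝ / 2πℤ`. -/
abbrev circleMeasure : Measure ℝ := volume.restrict (Ioc 0 (2 * π))

theorem absolutelyContinuousOnInterval_const {F : Type*} [NormedAddCommGroup F] [NormedSpace ℝ F]
    (v : F) (a b : ℝ) : AbsolutelyContinuousOnInterval (fun _ : ℝ => v) a b :=
  contDiffOn_const.absolutelyContinuousOnInterval

theorem absolutelyContinuousOnInterval_sum {F ι : Type*} [NormedAddCommGroup F] [NormedSpace ℝ F]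
    (s : Finset ι) {f : ι → ℝ → F} {a b : ℝ}
    (hf : ∀ i ∈ s, AbsolutelyContinuousOnInterval (f i) a b) :
    AbsolutelyContinuousOnInterval (fun t => ∑ i ∈ s, f i t) a b := by
  classical
  induction s using Finset.induction_on with
  | empty => simpa using absolutelyContinuousOnInterval_const (0 : F) a b
  | insert i s hi ih =>
    simp only [Finset.sum_insert hi]
    exact (hf i (Finset.mem_insert_self i s)).add
      (ih fun j hj => hf j (Finset.mem_insert_of_mem hj))

/-- Expanding the integral in the standard basis writes the function as a finite sum of scalar
indefinite integrals times `C¹` vector functions, each absolutely continuous. -/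
theorem absolutelyContinuousOnInterval_clm_apply_integral {F : Type*} [NormedAddCommGroup F]
    [NormedSpace ℝ F] {a b : ℝ} {c : ℝ → (𝔼 q) →L[ℝ] F} (hc : ContDiff ℝ 1 c) {k : ℝ → 𝔼 q}
    (hk : IntervalIntegrable k volume a b) :
    AbsolutelyContinuousOnInterval (fun t => c t (∫ s in a..t, k s)) a b := by
  have hki : ∀ i, IntervalIntegrable (fun t => k t i) volume a b := fun i =>
    ⟨(EuclideanSpace.proj (𝕜 := ℝ) i : (𝔼 q) →L[ℝ] ℝ).integrable_comp hk.1,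
      (EuclideanSpace.proj (𝕜 := ℝ) i : (𝔼 q) →L[ℝ] ℝ).integrable_comp hk.2⟩
  have h : ∀ i, AbsolutelyContinuousOnInterval
      (fun t => (∫ s in a..t, k s i) • c t (EuclideanSpace.single i 1)) a b := fun i =>
    ((hki i).absolutelyContinuousOnInterval_intervalIntegral left_mem_uIcc).fun_smul
      (hc.clm_apply contDiff_const).contDiffOn.absolutelyContinuousOnInterval
  have h2 := absolutelyContinuousOnInterval_sum Finset.univ fun i _ => h i
  have key : ∀ t ∈ uIcc a b, c t (∫ s in a..t, k s) =
      ∑ i, (∫ s in a..t, k s i) • c t (EuclideanSpace.single i 1) := by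
    intro t ht
    have hkt : IntervalIntegrable k volume a t :=
      hk.mono_set (uIcc_subset_uIcc left_mem_uIcc ht)
    have h3 : ∀ i, ∫ s in a..t, k s i = (∫ s in a..t, k s) i := fun i =>
      (EuclideanSpace.proj (𝕜 := ℝ) i : (𝔼 q) →L[ℝ] ℝ).intervalIntegral_comp_comm hkt
    conv_lhs => rw [← (EuclideanSpace.basisFun (Fin q) ℝ).sum_repr (∫ s in a..t, k s)]
    simp [h3]
  rw [absolutelyContinuousOnInterval_iff] at h2 ⊢
  intro ε hε
  obtain ⟨δ, hδ, h4⟩ := h2 ε hε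
  refine ⟨δ, hδ, fun E hE hE' => (le_of_eq (Finset.sum_congr rfl fun i hi => ?_)).trans_lt
    (h4 E hE hE')⟩
  have h5 := hE.1 i hi
  rw [key _ h5.1, key _ h5.2]

/-- The product rule for a `C^1` family of operators applied to an indefinite integral. -/
theorem clm_apply_eq_add_integral {b : ℝ} (hb : 0 ≤ b)
    {c : ℝ → (𝔼 q) →L[ℝ] (𝔼 q)}
    (hc : ContDiff ℝ 1 c) {h k : ℝ → 𝔼 q} (hk : IntervalIntegrable k volume 0 b)
    (hh : ∀ t ∈ Icc 0 b, h t = h 0 + ∫ s in (0 : ℝ)..t, k s)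
    (hi : IntervalIntegrable (fun s => deriv c s (h s) + c s (k s)) volume 0 b) :
    ∀ t ∈ Icc 0 b, c t (h t) = c 0 (h 0) + ∫ s in (0 : ℝ)..t, (deriv c s (h s) + c s (k s)) := by
  -- The difference of the two sides is absolutely continuous with derivative zero almost
  -- everywhere, hence constant; the constant is its value `c 0 (h 0)` at `0`.
  have hac : AbsolutelyContinuousOnInterval (fun t => c t (h 0) + c t (∫ s in (0 : ℝ)..t, k s)
      - ∫ s in (0 : ℝ)..t, (deriv c s (h s) + c s (k s))) 0 b :=
    ((hc.clm_apply contDiff_const).contDiffOn.absolutelyContinuousOnInterval.fun_add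
      (absolutelyContinuousOnInterval_clm_apply_integral hc hk)).fun_sub
      (absolutelyContinuousOnInterval_clm_apply_integral
        (c := fun _ => ContinuousLinearMap.id ℝ _) contDiff_const hi)
  have hder : ∀ᵐ t, t ∈ uIcc 0 b → HasDerivAt (fun t => c t (h 0) + c t (∫ s in (0 : ℝ)..t, k s)
      - ∫ s in (0 : ℝ)..t, (deriv c s (h s) + c s (k s))) 0 t := by
    filter_upwards [hk.ae_hasDerivAt_integral, hi.ae_hasDerivAt_integral] with t h1 h2 ht
    have hct : HasDerivAt c (deriv c t) t := (hc.differentiable one_ne_zero t).hasDerivAt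
    have h3 := ((hct.clm_apply (hasDerivAt_const t (h 0))).add
      (hct.clm_apply (h1 ht 0 left_mem_uIcc))).sub (h2 ht 0 left_mem_uIcc)
    refine h3.congr_deriv ?_
    rw [uIcc_of_le hb] at ht
    rw [hh t ht]
    simp only [map_add, map_zero]
    abel
  obtain ⟨C, hC⟩ := hac.const_of_ae_hasDerivAt_zero hder
  intro t ht
  rw [uIcc_of_le hb] at hC
  have h1 := hC t ht
  have h2 := hC 0 ⟨le_rfl, hb⟩
  simp only [intervalIntegral.integral_same, map_zero, add_zero, sub_zero] at h2
  rw [← h2, ← map_add, ← hh t ht, sub_eq_iff_eq_add] at h1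
  exact h1

theorem memLp_of_continuous {F : Type*} [NormedAddCommGroup F] {f : ℝ → F}
    [SecondCountableTopologyEither ℝ F] (hf : Continuous f) {p : ENNReal} :
    MemLp f p circleMeasure := by
  obtain ⟨C, hC⟩ := (isCompact_Icc (a := (0 : ℝ)) (b := 2 * π)).exists_bound_of_continuousOn
    hf.continuousOn
  refine MemLp.of_bound hf.aestronglyMeasurable C ?_
  filter_upwards [ae_restrict_mem measurableSet_Ioc] with t ht
  exact hC t (Ioc_subset_Icc_self ht)

theorem memLp_clm_apply {c : ℝ → (𝔼 q) →L[ℝ] (𝔼 q)} (hc : Continuous c) {k : ℝ → 𝔼 q}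
    {p : ENNReal} (hk : MemLp k p circleMeasure) :
    MemLp (fun t => c t (k t)) p circleMeasure := by
  obtain ⟨C, hC⟩ := (isCompact_Icc (a := (0 : ℝ)) (b := 2 * π)).exists_bound_of_continuousOn
    hc.continuousOn
  refine hk.of_le_mul (c := C) ?_ ?_
  · exact (isBoundedBilinearMap_apply (𝕜 := ℝ) (E := 𝔼 q) (F := 𝔼 q)).continuous.comp_aestronglyMeasurable
      (hc.aestronglyMeasurable.prodMk hk.1)
  · filter_upwards [ae_restrict_mem measurableSet_Ioc] with t ht
    exact ((c t).le_opNorm _).trans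
      (mul_le_mul_of_nonneg_right (hC t (Ioc_subset_Icc_self ht)) (norm_nonneg _))

theorem intervalIntegrable_of_memLp {F : Type*} [NormedAddCommGroup F] {f : ℝ → F}
    (hf : MemLp f 2 circleMeasure) : IntervalIntegrable f volume 0 (2 * π) := by
  rw [intervalIntegrable_iff_integrableOn_Ioc_of_le (by positivity)]
  exact hf.integrable one_le_two

theorem IsW22.ae_hasDerivAt_deriv {f g : ℝ → 𝔼 q} (hg : MemLp g 2 circleMeasure)
    (hfg : ∀ t ∈ Icc (0 : ℝ) (2 * π), deriv f t = deriv f 0 + ∫ s in (0 : ℝ)..t, g s) :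
    ∀ᵐ t ∂circleMeasure, HasDerivAt (deriv f) (g t) t := by
  have h1 := (intervalIntegrable_of_memLp hg).ae_hasDerivAt_integral
  -- The integral formula is available only on `[0, 2π]`, so the right endpoint, which has no
  -- neighbourhood in that interval, is discarded; the left one is already outside `Ioc`.
  have h2 : ∀ᵐ t : ℝ, t ≠ 2 * π := by simp [ae_iff, measure_singleton]
  rw [ae_restrict_iff' measurableSet_Ioc]
  filter_upwards [h1, h2] with t ht ht2 htI
  have h3 := (ht (by rw [uIcc_of_le (by positivity)]; exact Ioc_subset_Icc_self htI) 0
    left_mem_uIcc).const_add (deriv f 0)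
  refine h3.congr_of_eventuallyEq ?_
  filter_upwards [Ioo_mem_nhds htI.1 (lt_of_le_of_ne htI.2 ht2)] with s hs
  exact hfg s (Ioo_subset_Icc_self hs)

theorem IsW22.ae_hasDerivAt {f : ℝ → 𝔼 q} (hf : IsW22 f) :
    ∀ᵐ t ∂circleMeasure, HasDerivAt (deriv f) (deriv (deriv f) t) t := by
  obtain ⟨g, hg, hfg⟩ := hf.exists_second_deriv
  filter_upwards [IsW22.ae_hasDerivAt_deriv hg hfg] with t ht
  exact ht.differentiableAt.hasDerivAt

theorem IsW22.memLp_deriv_deriv {f : ℝ → 𝔼 q} (hf : IsW22 f) :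
    MemLp (deriv (deriv f)) 2 circleMeasure := by
  obtain ⟨g, hg, hfg⟩ := hf.exists_second_deriv
  refine hg.ae_eq ?_
  filter_upwards [IsW22.ae_hasDerivAt_deriv hg hfg] with t ht
  exact ht.deriv.symm

theorem IsW22.differentiable {f : ℝ → 𝔼 q} (hf : IsW22 f) : Differentiable ℝ f :=
  hf.contDiff.differentiable one_ne_zero

theorem IsW22.continuous {f : ℝ → 𝔼 q} (hf : IsW22 f) : Continuous f := hf.contDiff.continuous

theorem IsW22.continuous_deriv {f : ℝ → 𝔼 q} (hf : IsW22 f) : Continuous (deriv f) :=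
  hf.contDiff.continuous_deriv le_rfl

theorem deriv_clm_comp_apply {A : (𝔼 q) → (𝔼 q) →L[ℝ] (𝔼 q)} (hA : ContDiff ℝ 2 A)
    {u v : ℝ → 𝔼 q} (hu : IsW22 u) (hv : IsW22 v) (t : ℝ) :
    deriv (fun s => A (u s) (v s)) t =
      fderiv ℝ A (u t) (deriv u t) (v t) + A (u t) (deriv v t) := by
  have h1 : HasDerivAt (fun s => A (u s)) (fderiv ℝ A (u t) (deriv u t)) t :=
    (hA.differentiable (by norm_num) (u t)).hasFDerivAt.comp_hasDerivAt t
      (hu.differentiable t).hasDerivAt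
  exact (h1.clm_apply (hv.differentiable t).hasDerivAt).deriv

/-- The derivative is `c (u') + a (v')` with `a = A ∘ u` and `c` the differential of `A` along `u`
applied to `v`. Both coefficients are `C¹` because they contain `u` and `v` only undifferentiated,
so the product rule for indefinite integrals applies to each summand. -/
theorem IsW22.clm_comp_apply {A : (𝔼 q) → (𝔼 q) →L[ℝ] (𝔼 q)} (hA : ContDiff ℝ 2 A)
    {u v : ℝ → 𝔼 q} (hu : IsW22 u) (hv : IsW22 v) : IsW22 (fun t => A (u t) (v t)) where
  periodic t := by simp only [hu.periodic t, hv.periodic t]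
  contDiff := ((hA.of_le (by norm_num)).comp hu.contDiff).clm_apply hv.contDiff
  exists_second_deriv := by
    obtain ⟨gu, hgu, hu'⟩ := hu.exists_second_deriv
    obtain ⟨gv, hgv, hv'⟩ := hv.exists_second_deriv
    set a : ℝ → (𝔼 q) →L[ℝ] (𝔼 q) := fun t => A (u t) with ha
    -- Flipping the arguments isolates `u'` as the vector to which the `C¹` operator is applied.
    set c : ℝ → (𝔼 q) →L[ℝ] (𝔼 q) := fun t => (fderiv ℝ A (u t)).flip (v t) with hc
    have ha1 : ContDiff ℝ 1 a := (hA.of_le (by norm_num)).comp hu.contDiff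
    have hc1 : ContDiff ℝ 1 c := contDiff_clm_apply_iff.mpr fun y =>
      contDiff_fderiv_apply hA hu.contDiff contDiff_const hv.contDiff
    have hm : ∀ {c : ℝ → (𝔼 q) →L[ℝ] (𝔼 q)} {f k : ℝ → 𝔼 q}, ContDiff ℝ 1 c → IsW22 f →
        MemLp k 2 circleMeasure →
        MemLp (fun s => deriv c s (deriv f s) + c s (k s)) 2 circleMeasure :=
      fun hc hf hk => (memLp_of_continuous ((hc.continuous_deriv le_rfl).clm_apply
        hf.continuous_deriv)).add (memLp_clm_apply hc.continuous hk)
    have h1 := hm hc1 hu hgu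
    have h2 := hm ha1 hv hgv
    refine ⟨_, h1.add h2, fun t ht => ?_⟩
    have hd : ∀ s, deriv (fun s => A (u s) (v s)) s = c s (deriv u s) + a s (deriv v s) :=
      deriv_clm_comp_apply hA hu hv
    have hI : ∀ {f : ℝ → 𝔼 q}, MemLp f 2 circleMeasure → IntervalIntegrable f volume 0 t :=
      fun hf => (intervalIntegrable_of_memLp hf).mono_set
        (uIcc_subset_uIcc left_mem_uIcc (by rwa [uIcc_of_le (by positivity)]))
    rw [hd, hd,
      clm_apply_eq_add_integral (by positivity) hc1 (intervalIntegrable_of_memLp hgu) hu'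
        (intervalIntegrable_of_memLp h1) t ht,
      clm_apply_eq_add_integral (by positivity) ha1 (intervalIntegrable_of_memLp hgv) hv'
        (intervalIntegrable_of_memLp h2) t ht]
    simp only [Pi.add_apply]
    rw [intervalIntegral.integral_add (hI h1) (hI h2)]
    abel

/-! ### First-order expressions along curves of constant speed. -/

theorem IsImmersion.deriv_mem_tangentSpaceAt {M : Set (𝔼 q)} {u : ℝ → 𝔼 q}
    (hu : IsImmersion M u) (t : ℝ) : deriv u t ∈ tangentSpaceAt M (u t) := by
  refine Submodule.subset_span ?_
  have h1 := (hu.isW22.differentiable t).hasDerivAt.hasFDerivAt.hasFDerivWithinAt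
    (s := univ) |>.mapsTo_tangent_cone
  have h2 := h1 (by rw [tangentConeAt_univ]; exact mem_univ (1 : ℝ))
  simp only [ContinuousLinearMap.toSpanSingleton_apply, one_smul] at h2
  refine tangentConeAt_mono ?_ h2
  rintro _ ⟨s, -, rfl⟩
  exact hu.mem s

/-- The tangential part of the derivative of `t ↦ A (u t) (v t)`, in terms of
`p = (u t, u' t, v t, v' t)`. -/
def projDeriv (A : (𝔼 q) → (𝔼 q) →L[ℝ] (𝔼 q)) (p : (𝔼 q) × (𝔼 q) × (𝔼 q) × (𝔼 q)) : 𝔼 q :=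
  A p.1 (fderiv ℝ A p.1 p.2.1 p.2.2.1 + A p.1 p.2.2.2)

theorem contDiff_projDeriv {A : (𝔼 q) → (𝔼 q) →L[ℝ] (𝔼 q)} (hA : ContDiff ℝ 2 A) :
    ContDiff ℝ 1 (projDeriv A) :=
  contDiff_apply hA contDiff_fst ((contDiff_fderiv_apply hA contDiff_fst (by fun_prop)
    (by fun_prop)).add (contDiff_apply hA contDiff_fst (by fun_prop)))

/-- The integrand of the second variation of length, in terms of
`p = (u t, u' t, |u' t|⁻¹, v t, v' t)`. -/
def lengthIntegrand (A : (𝔼 q) → (𝔼 q) →L[ℝ] (𝔼 q))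
    (p : (𝔼 q) × (𝔼 q) × ℝ × (𝔼 q) × (𝔼 q)) : ℝ :=
  ‖p.2.2.1 • projDeriv A (p.1, p.2.1, p.2.2.2)‖ ^ 2
    - ⟪p.2.2.1 • projDeriv A (p.1, p.2.1, p.2.2.2), p.2.2.1 • p.2.1⟫_ℝ ^ 2
    - ⟪curvExt A p.1 (p.2.2.1 • p.2.1) (A p.1 p.2.2.2.1) (A p.1 p.2.2.2.1), p.2.2.1 • p.2.1⟫_ℝ

theorem continuous_lengthIntegrand {A : (𝔼 q) → (𝔼 q) →L[ℝ] (𝔼 q)} (hA : ContDiff ℝ 2 A) :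
    Continuous (lengthIntegrand A) := by
  have h1 : Continuous fun p : (𝔼 q) × (𝔼 q) × ℝ × (𝔼 q) × (𝔼 q) =>
      p.2.2.1 • projDeriv A (p.1, p.2.1, p.2.2.2) :=
    (continuous_fst.comp (continuous_snd.comp continuous_snd)).smul
      ((contDiff_projDeriv hA).continuous.comp (continuous_fst.prodMk
        ((continuous_fst.comp continuous_snd).prodMk
          (continuous_snd.comp (continuous_snd.comp continuous_snd)))))
  have h2 : ContDiff ℝ 1 fun p : (𝔼 q) × (𝔼 q) × ℝ × (𝔼 q) × (𝔼 q) => p.2.2.1 • p.2.1 :=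
    (contDiff_fst.comp (contDiff_snd.comp contDiff_snd)).smul (contDiff_fst.comp contDiff_snd)
  have h3 : ContDiff ℝ 1 fun p : (𝔼 q) × (𝔼 q) × ℝ × (𝔼 q) × (𝔼 q) => A p.1 p.2.2.2.1 :=
    contDiff_apply hA contDiff_fst (by fun_prop)
  exact ((h1.norm.pow 2).sub ((h1.inner h2.continuous).pow 2)).sub
    ((contDiff_curvExt hA contDiff_fst h2 h3 h3).continuous.inner h2.continuous)

/-- `u` is an immersed curve in `M` of constant speed `l` and `v` is a `W^{2,2}` map, with bounds
`r` on the first-order quantities. -/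
structure IsBoundedPair (M : Set (𝔼 q)) (r l : ℝ) (u v : ℝ → 𝔼 q) : Prop where
  isImmersion : IsImmersion M u
  speed : ∀ t, ‖deriv u t‖ = l
  speed_le : l ≤ r
  inv_speed_le : l⁻¹ ≤ r
  isW22 : IsW22 v
  norm_le : ∀ t, ‖v t‖ ≤ r
  norm_deriv_le : ∀ t, ‖deriv v t‖ ≤ r

namespace IsBoundedPair

variable {M : Set (𝔼 q)} {r l : ℝ} {u v : ℝ → 𝔼 q} {A : (𝔼 q) → (𝔼 q) →L[ℝ] (𝔼 q)}

theorem speed_pos (h : IsBoundedPair M r l u v) : 0 < l := by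
  rw [← h.speed 0]
  exact norm_pos_iff.mpr (h.isImmersion.deriv_ne_zero 0)

theorem bound_pos (h : IsBoundedPair M r l u v) : 0 < r := h.speed_pos.trans_le h.speed_le

theorem unitTangent_eq (h : IsBoundedPair M r l u v) (t : ℝ) :
    unitTangent u t = l⁻¹ • deriv u t := by
  rw [unitTangent, h.speed]

theorem norm_unitTangent (h : IsBoundedPair M r l u v) (t : ℝ) : ‖unitTangent u t‖ = 1 := by
  rw [h.unitTangent_eq, norm_smul, h.speed, norm_inv, Real.norm_of_nonneg h.speed_pos.le,
    inv_mul_cancel₀ h.speed_pos.ne']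

theorem unitTangent_mem (h : IsBoundedPair M r l u v) (t : ℝ) :
    unitTangent u t ∈ tangentSpaceAt M (u t) :=
  Submodule.smul_mem _ _ (h.isImmersion.deriv_mem_tangentSpaceAt t)

theorem curvatureVector_eq (h : IsBoundedPair M r l u v) (t : ℝ) :
    curvatureVector M u t = l⁻¹ • tangentProj M (u t) (l⁻¹ • deriv (deriv u) t) := by
  have h1 : unitTangent u = l⁻¹ • deriv u := funext h.unitTangent_eq
  rw [curvatureVector, covDeriv, h.speed, h1, deriv_const_smul_field]

theorem covDeriv_eq (h : IsBoundedPair M r l u v) (hA : ContDiff ℝ 2 A)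
    (hAM : ∀ x ∈ M, A x = tangentProj M x) :
    covDeriv M u (fun t => A (u t) (v t)) =
      fun t => l⁻¹ • projDeriv A (u t, deriv u t, v t, deriv v t) := by
  funext t
  rw [covDeriv, h.speed, deriv_clm_comp_apply hA h.isImmersion.isW22 h.isW22, projDeriv,
    hAM _ (h.isImmersion.mem t)]

theorem norm_apply_le (h : IsBoundedPair M r l u v) (hAM : ∀ x ∈ M, A x = tangentProj M x)
    (t : ℝ) : ‖A (u t) (v t)‖ ≤ r := by
  rw [hAM _ (h.isImmersion.mem t)]
  exact (norm_tangentProj_apply_le _ _ _).trans (h.norm_le t)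

/-- Differentiating `A(u) u' = u'` gives `u'' = DA(u)(u') u' + A(u) u''`. The first term is the
second fundamental form, quadratic in the speed; the second is `l²` times the curvature vector. Thus
geodesic curvature controls the full second derivative. -/
theorem norm_deriv_deriv_le (h : IsBoundedPair M r l u v) (hA : ContDiff ℝ 2 A)
    (hAM : ∀ x ∈ M, A x = tangentProj M x) {C : ℝ} (hC : ∀ x ∈ M, ‖fderiv ℝ A x‖ ≤ C) {t : ℝ}
    (ht : HasDerivAt (deriv u) (deriv (deriv u) t) t) :
    ‖deriv (deriv u) t‖ ≤ C * l ^ 2 + l ^ 2 * ‖curvatureVector M u t‖ := by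
  have hu := h.isImmersion
  have h1 : HasDerivAt (fun s => A (u s)) (fderiv ℝ A (u t) (deriv u t)) t :=
    (hA.differentiable (by norm_num) (u t)).hasFDerivAt.comp_hasDerivAt t
      (hu.isW22.differentiable t).hasDerivAt
  have h2 : (fun s => A (u s) (deriv u s)) = deriv u := by
    funext s
    rw [hAM _ (hu.mem s), tangentProj_apply_of_mem (hu.deriv_mem_tangentSpaceAt s)]
  have h3 := h1.clm_apply ht
  rw [h2] at h3
  have h4 : A (u t) (deriv (deriv u) t) = (l ^ 2) • curvatureVector M u t := by
    have := h.speed_pos.ne'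
    rw [h.curvatureVector_eq, map_smul, smul_smul, smul_smul, hAM _ (hu.mem t)]
    field_simp
    rw [one_smul]
  rw [ht.unique h3]
  refine (norm_add_le _ _).trans (add_le_add ?_ ?_)
  · refine (ContinuousLinearMap.le_opNorm _ _).trans ?_
    have h5 := (fderiv ℝ A (u t)).le_opNorm (deriv u t)
    rw [h.speed] at h5 ⊢
    calc _ ≤ (C * l) * l := by
          gcongr
          · exact h.speed_pos.le
          · refine h5.trans ?_
            gcongr
            · exact h.speed_pos.le
            · exact hC _ (hu.mem t)
      _ = C * l ^ 2 := by ring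
  · rw [h4, norm_smul, Real.norm_of_nonneg (by positivity)]

theorem memLp_curvatureVector (h : IsBoundedPair M r l u v) (hA : ContDiff ℝ 2 A)
    (hAM : ∀ x ∈ M, A x = tangentProj M x) : MemLp (curvatureVector M u) 2 circleMeasure := by
  have hu := h.isImmersion
  have h1 : MemLp (fun t => A (u t) (deriv (deriv u) t)) 2 circleMeasure :=
    memLp_clm_apply (hA.continuous.comp hu.isW22.continuous) hu.isW22.memLp_deriv_deriv
  have h2 : curvatureVector M u = (l⁻¹ * l⁻¹) • fun t => A (u t) (deriv (deriv u) t) := by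
    funext t
    rw [h.curvatureVector_eq, map_smul, smul_smul, Pi.smul_apply, hAM _ (hu.mem t)]
  rw [h2]
  exact h1.const_smul _

theorem integrable_geodesicCurvature_sq (h : IsBoundedPair M r l u v) (hA : ContDiff ℝ 2 A)
    (hAM : ∀ x ∈ M, A x = tangentProj M x) :
    Integrable (fun t => geodesicCurvature M u t ^ 2) circleMeasure :=
  (h.memLp_curvatureVector hA hAM).integrable_norm_pow two_ne_zero

end IsBoundedPair

/-! ### Uniform bounds on covariant derivatives of projected fields. -/

section Bounds

variable {M : Set (𝔼 q)} {A : (𝔼 q) → (𝔼 q) →L[ℝ] (𝔼 q)}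

theorem exists_norm_covDeriv_le (hM : IsCompact M) (hA : ContDiff ℝ 2 A)
    (hAM : ∀ x ∈ M, A x = tangentProj M x) (r : ℝ) :
    ∃ C, 0 ≤ C ∧ ∀ l u v, IsBoundedPair M r l u v →
      ∀ t, ‖covDeriv M u (fun t => A (u t) (v t)) t‖ ≤ C := by
  have hB : IsCompact (Metric.closedBall (0 : 𝔼 q) r) := isCompact_closedBall _ _
  obtain ⟨C, hC⟩ := (hM.prod (hB.prod (hB.prod hB))).exists_bound_of_continuousOn
    (contDiff_projDeriv hA).continuous.continuousOn
  refine ⟨|r| * max C 0, by positivity, fun l u v h t => ?_⟩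
  rw [h.covDeriv_eq hA hAM, norm_smul, norm_inv, Real.norm_of_nonneg h.speed_pos.le]
  gcongr
  · exact h.inv_speed_le.trans (le_abs_self r)
  · refine (hC _ ?_).trans (le_max_left _ _)
    simp [h.isImmersion.mem t, h.speed t, h.speed_le, h.norm_le t, h.norm_deriv_le t]

/-- The first covariant derivative is a `C¹` function of `(u, u', v, v')`, which stays in a compact
set. Its derivative along the curve is linear in `(u', u'', v', v'')`, and `u''` is controlled by
the curvature vector. -/
theorem exists_norm_covDeriv_covDeriv_le (hM : IsCompact M) (hA : ContDiff ℝ 2 A)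
    (hAM : ∀ x ∈ M, A x = tangentProj M x) (r : ℝ) :
    ∃ C, 0 ≤ C ∧ ∀ l u v, IsBoundedPair M r l u v → ∀ᵐ t ∂circleMeasure,
      ‖covDeriv M u (covDeriv M u (fun t => A (u t) (v t))) t‖ ≤
        C * (1 + ‖curvatureVector M u t‖ + ‖deriv (deriv v) t‖) := by
  have hB : IsCompact (Metric.closedBall (0 : 𝔼 q) r) := isCompact_closedBall _ _
  obtain ⟨C, hC⟩ := (hM.prod (hB.prod (hB.prod hB))).exists_bound_of_continuousOn
    ((contDiff_projDeriv hA).continuous_fderiv one_ne_zero).continuousOn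
  obtain ⟨C₀, hC₀⟩ := hM.exists_bound_of_continuousOn
    (hA.continuous_fderiv (by norm_num)).continuousOn
  refine ⟨r ^ 2 * (|C| * (2 * |r| + |C₀| * r ^ 2 + r ^ 2 + 1)), by positivity,
    fun l u v h => ?_⟩
  have hu := h.isImmersion
  filter_upwards [hu.isW22.ae_hasDerivAt, h.isW22.ae_hasDerivAt] with t hut hvt
  have hl := h.speed_pos
  have hr := h.bound_pos
  set k := ‖curvatureVector M u t‖ with hk
  set w := ‖deriv (deriv v) t‖ with hw
  have hk0 : 0 ≤ k := norm_nonneg _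
  have hw0 : 0 ≤ w := norm_nonneg _
  have h1 : HasDerivAt (fun s => projDeriv A (u s, deriv u s, v s, deriv v s))
      (fderiv ℝ (projDeriv A) (u t, deriv u t, v t, deriv v t)
        (deriv u t, deriv (deriv u) t, deriv v t, deriv (deriv v) t)) t :=
    ((contDiff_projDeriv hA).differentiable one_ne_zero _).hasFDerivAt.comp_hasDerivAt t
      ((hu.isW22.differentiable t).hasDerivAt.prodMk
        (hut.prodMk ((h.isW22.differentiable t).hasDerivAt.prodMk hvt)))
  have h2 : ‖deriv (deriv u) t‖ ≤ |C₀| * r ^ 2 + r ^ 2 * k := by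
    refine (h.norm_deriv_deriv_le hA hAM hC₀ hut).trans ?_
    gcongr
    · exact le_abs_self _
    · exact h.speed_le
    · exact h.speed_le
  have h3 : ‖(deriv u t, deriv (deriv u) t, deriv v t, deriv (deriv v) t)‖ ≤
      (2 * |r| + |C₀| * r ^ 2 + r ^ 2 + 1) * (1 + k + w) := by
    have h4 : ‖deriv u t‖ ≤ |r| := by
      rw [h.speed]
      exact h.speed_le.trans (le_abs_self r)
    have h5 : ‖deriv v t‖ ≤ |r| := (h.norm_deriv_le t).trans (le_abs_self r)
    have h6 : (2 * |r| + |C₀| * r ^ 2 + r ^ 2 + 1) * (1 + k + w) =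
        2 * |r| + (|C₀| * r ^ 2 + r ^ 2 * k) + w + (r ^ 2 + 1) + k +
          (2 * |r| + |C₀| * r ^ 2) * (k + w) + r ^ 2 * w := by ring
    have h7 : 0 ≤ (2 * |r| + |C₀| * r ^ 2) * (k + w) := by positivity
    have h8 : 0 ≤ r ^ 2 * w := by positivity
    have h9 : 0 ≤ |C₀| * r ^ 2 + r ^ 2 * k := by positivity
    have h10 : 0 ≤ r ^ 2 := by positivity
    have h11 := abs_nonneg r
    rw [h6]
    simp only [Prod.norm_mk, sup_le_iff]
    refine ⟨?_, ?_, ?_, ?_⟩ <;> linarith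
  rw [h.covDeriv_eq hA hAM, covDeriv, h.speed, deriv_fun_const_smul_field, h1.deriv, map_smul,
    smul_smul, norm_smul, norm_mul, norm_inv, Real.norm_of_nonneg hl.le]
  have h4 := (norm_tangentProj_apply_le M (u t)
    (fderiv ℝ (projDeriv A) (u t, deriv u t, v t, deriv v t)
        (deriv u t, deriv (deriv u) t, deriv v t, deriv (deriv v) t))).trans
    (ContinuousLinearMap.le_opNorm _ _)
  have h5 : ‖fderiv ℝ (projDeriv A) (u t, deriv u t, v t, deriv v t)‖ ≤ |C| := by
    refine (hC _ ?_).trans (le_abs_self C)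
    simp [hu.mem t, h.speed t, h.speed_le, h.norm_le t, h.norm_deriv_le t]
  calc _ ≤ (r * r) * (|C| * ((2 * |r| + |C₀| * r ^ 2 + r ^ 2 + 1) * (1 + k + w))) := by
        refine mul_le_mul ?_ (h4.trans ?_) (norm_nonneg _) (by positivity)
        · exact mul_le_mul h.inv_speed_le h.inv_speed_le (by positivity) hr.le
        · exact mul_le_mul h5 h3 (norm_nonneg _) (abs_nonneg C)
    _ = _ := by ring

end Bounds

/-! ### Quadratic growth of the `σ²` integrands. -/

theorem abs_mul_le_of_abs_le {x y X Y : ℝ} (hx : |x| ≤ X) (hy : |y| ≤ Y) : |x * y| ≤ X * Y := by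
  rw [abs_mul]
  exact mul_le_mul hx hy (abs_nonneg y) ((abs_nonneg x).trans hx)

theorem monomials_le {B D k : ℝ} (hB : 1 ≤ B) (hD : 0 ≤ D) (hk : 0 ≤ k) :
    B * k ≤ B ^ 2 * (1 + D ^ 2 + k ^ 2) ∧ B * D ≤ B ^ 2 * (1 + D ^ 2 + k ^ 2) ∧
    B * k ^ 2 ≤ B ^ 2 * (1 + D ^ 2 + k ^ 2) ∧ B ^ 2 * k ^ 2 ≤ B ^ 2 * (1 + D ^ 2 + k ^ 2) ∧
    B * (D * k) ≤ B ^ 2 * (1 + D ^ 2 + k ^ 2) ∧ B * (B * k) ≤ B ^ 2 * (1 + D ^ 2 + k ^ 2) ∧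
    B ^ 2 ≤ B ^ 2 * (1 + D ^ 2 + k ^ 2) ∧ D ^ 2 ≤ B ^ 2 * (1 + D ^ 2 + k ^ 2) := by
  have hB0 : 0 ≤ B := zero_le_one.trans hB
  have hBB : B ≤ B ^ 2 := by nlinarith only [hB]
  have h1B : 1 ≤ B ^ 2 := hB.trans hBB
  have hD2 := sq_nonneg D
  have hk2 := sq_nonneg k
  have hk1 : k ≤ 1 + D ^ 2 + k ^ 2 := by nlinarith only [sq_nonneg (k - 1), hD2, hk2]
  have hD1 : D ≤ 1 + D ^ 2 + k ^ 2 := by nlinarith only [sq_nonneg (D - 1), hD2, hk2]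
  have hDk : D * k ≤ 1 + D ^ 2 + k ^ 2 := by nlinarith only [sq_nonneg (D - k), hD2, hk2]
  refine ⟨mul_le_mul hBB hk1 hk (sq_nonneg B), mul_le_mul hBB hD1 hD (sq_nonneg B),
    mul_le_mul hBB (by linarith) hk2 (sq_nonneg B),
    mul_le_mul_of_nonneg_left (by linarith) (sq_nonneg B),
    mul_le_mul hBB hDk (mul_nonneg hD hk) (sq_nonneg B), ?_,
    le_mul_of_one_le_right (sq_nonneg B) (by linarith), ?_⟩
  · rw [← mul_assoc, ← sq]
    exact mul_le_mul_of_nonneg_left hk1 (sq_nonneg B)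
  · rw [← one_mul (D ^ 2)]
    exact mul_le_mul h1B (by linarith) (by linarith) (sq_nonneg B)

/-- The scalars stand for the norms and inner products in the integrands, with `D` the size of the
second covariant derivative of the field and `k` that of the curvature vector. Every term is at most
quadratic in `(D, k)`; this is what matches the integrability of `κ²` and `|v''|²`. The factor `100`
is a crude bound for the sum of the coefficients. -/
theorem abs_curvatureSecondVariation_terms_le {B D k ρ n x y z p s a₁ a₂ a₃ a₄ a₅ a₆ a₇ a₈ : ℝ}
    (hB : 1 ≤ B) (hD : 0 ≤ D) (hk : 0 ≤ k) (hρ : |ρ| ≤ B) (hn : |n| ≤ B) (hx : |x| ≤ B)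
    (hy : |y| ≤ B) (hz : |z| ≤ D) (hp : |p| ≤ B * k) (hs : |s| ≤ D * k) (h₁ : |a₁| ≤ B * k)
    (h₂ : |a₂| ≤ B * k) (h₃ : |a₃| ≤ B * k) (h₄ : |a₄| ≤ B * k ^ 2) (h₅ : |a₅| ≤ B * k)
    (h₆ : |a₆| ≤ B * k) (h₇ : |a₇| ≤ B * D) (h₈ : |a₈| ≤ B * k) :
    |D ^ 2 + ρ ^ 2 + 2 * (4 * x ^ 2 + 2 * x ^ 2 - n ^ 2 + y) * k ^ 2 - (z + p) ^ 2 - 8 * x * s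
      + a₁ + a₂ + a₃ - a₄ + 3 * a₅ + a₆ + 2 * a₇ - 8 * x * a₈| ≤
      100 * B ^ 2 * (1 + D ^ 2 + k ^ 2) ∧
    |x * (s - 2 * x * k ^ 2 + a₈)| ≤ 100 * B ^ 2 * (1 + D ^ 2 + k ^ 2) := by
  obtain ⟨hBk, hBD, hBkk, hBBkk, hBDk, hBBk, hB2, hD2⟩ := monomials_le hB hD hk
  set Q := 1 + D ^ 2 + k ^ 2 with hQ
  have hsq : ∀ {x X : ℝ}, |x| ≤ X → x ^ 2 ≤ X ^ 2 := fun h => sq_le_sq' (abs_le.mp h).1 (abs_le.mp h).2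
  have t1 := hsq hρ
  have t2 : x ^ 2 * k ^ 2 ≤ B ^ 2 * k ^ 2 := mul_le_mul_of_nonneg_right (hsq hx) (sq_nonneg k)
  have t3 : n ^ 2 * k ^ 2 ≤ B ^ 2 * k ^ 2 := mul_le_mul_of_nonneg_right (hsq hn) (sq_nonneg k)
  have t4 : |y * k ^ 2| ≤ B * k ^ 2 :=
    abs_mul_le_of_abs_le hy (by rw [abs_of_nonneg (sq_nonneg k)])
  have t5 : (z + p) ^ 2 ≤ 2 * D ^ 2 + 2 * (B ^ 2 * k ^ 2) := by
    have h1 := hsq hz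
    have h2 := hsq hp
    nlinarith only [sq_nonneg (z - p), h1, h2]
  have t6 : |x * s| ≤ B * (D * k) := abs_mul_le_of_abs_le hx hs
  have t7 : |x * a₈| ≤ B * (B * k) := abs_mul_le_of_abs_le hx h₈
  have p1 := sq_nonneg ρ
  have p2 := mul_nonneg (sq_nonneg x) (sq_nonneg k)
  have p3 := mul_nonneg (sq_nonneg n) (sq_nonneg k)
  have p4 := sq_nonneg (z + p)
  have p5 := sq_nonneg D
  have p6 : 0 ≤ B ^ 2 * Q := (sq_nonneg B).trans hB2
  rw [abs_le] at t4 t6 t7 h₁ h₂ h₃ h₄ h₅ h₆ h₇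
  constructor
  · have e : D ^ 2 + ρ ^ 2 + 2 * (4 * x ^ 2 + 2 * x ^ 2 - n ^ 2 + y) * k ^ 2 - (z + p) ^ 2
        - 8 * x * s + a₁ + a₂ + a₃ - a₄ + 3 * a₅ + a₆ + 2 * a₇ - 8 * x * a₈ =
        D ^ 2 + ρ ^ 2 + 12 * (x ^ 2 * k ^ 2) - 2 * (n ^ 2 * k ^ 2) + 2 * (y * k ^ 2) - (z + p) ^ 2
        - 8 * (x * s) + a₁ + a₂ + a₃ - a₄ + 3 * a₅ + a₆ + 2 * a₇ - 8 * (x * a₈) := by ring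
    rw [e, abs_le]
    constructor <;> linarith [t4.1, t4.2, t6.1, t6.2, t7.1, t7.2, h₁.1, h₁.2, h₂.1, h₂.2, h₃.1,
      h₃.2, h₄.1, h₄.2, h₅.1, h₅.2, h₆.1, h₆.2, h₇.1, h₇.2]
  · have e : x * (s - 2 * x * k ^ 2 + a₈) = x * s - 2 * (x ^ 2 * k ^ 2) + x * a₈ := by ring
    rw [e, abs_le]
    constructor <;> linarith [t6.1, t6.2, t7.1, t7.2]

/-- The integrand of the second summand of the second variation, without the factor `4 σ²`. -/
def mixedIntegrand (M : Set (𝔼 q)) (u v : ℝ → 𝔼 q) (t : ℝ) : ℝ :=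
  ⟪covDeriv M u v t, unitTangent u t⟫_ℝ *
    (⟪covDeriv M u (covDeriv M u v) t, curvatureVector M u t⟫_ℝ
      - 2 * ⟪covDeriv M u v t, unitTangent u t⟫_ℝ * geodesicCurvature M u t ^ 2
      + ⟪curvature M (u t) (v t) (unitTangent u t) (unitTangent u t),
          curvatureVector M u t⟫_ℝ)

theorem exists_abs_curvatureSecondVariation_le {M : Set (𝔼 q)}
    {A : (𝔼 q) → (𝔼 q) →L[ℝ] (𝔼 q)} (hM : IsCompact M) (hA : ContDiff ℝ 2 A)
    (hAM : ∀ x ∈ M, A x = tangentProj M x) (r : ℝ) :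
    ∃ C, 0 ≤ C ∧ ∀ l u v, IsBoundedPair M r l u v → ∀ᵐ t ∂circleMeasure,
      |curvatureSecondVariation M u (fun t => A (u t) (v t)) t| ≤
        C * (1 + geodesicCurvature M u t ^ 2 + ‖deriv (deriv v) t‖ ^ 2) ∧
      |mixedIntegrand M u (fun t => A (u t) (v t)) t| ≤
        C * (1 + geodesicCurvature M u t ^ 2 + ‖deriv (deriv v) t‖ ^ 2) := by
  obtain ⟨c, hc0, hc⟩ := exists_norm_curvature_le hM hA hAM
  -- The radius `max 1 r` covers both the unit tangent and the field.
  obtain ⟨d, hd0, hd⟩ := exists_norm_curvatureDeriv_le hM hA hAM (max 1 r)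
  obtain ⟨C₁, hC₁, h1⟩ := exists_norm_covDeriv_le hM hA hAM r
  obtain ⟨C₂, hC₂, h2⟩ := exists_norm_covDeriv_covDeriv_le hM hA hAM r
  set b := max (max 1 r) C₁
  have hb1 : 1 ≤ b := (le_max_left _ _).trans (le_max_left _ _)
  have hbr : r ≤ b := (le_max_right _ _).trans (le_max_left _ _)
  -- Here `b` bounds the unit tangent, the field and its first covariant derivative; `B` then
  -- dominates `b` and the sizes of all curvature expressions formed from these vectors.
  set B := b + c * b ^ 2 + d with hBdef
  have hcb : 0 ≤ c * b ^ 2 := by positivity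
  have hbB : b ≤ B := by linarith
  have hcB : c * b ^ 2 ≤ B := by linarith
  have hdB : d ≤ B := by linarith
  have hcbB : c * b ≤ B := (mul_le_mul_of_nonneg_left (by nlinarith only [hb1]) hc0).trans hcB
  refine ⟨100 * B ^ 2 * (1 + 3 * C₂ ^ 2), by positivity, fun l u v h => ?_⟩
  filter_upwards [h2 l u v h] with t ht
  have hx := h.isImmersion.mem t
  have hT := h.norm_unitTangent t
  have hTm := h.unitTangent_mem t
  have hV : ‖A (u t) (v t)‖ ≤ r := h.norm_apply_le hAM t
  have hVm : A (u t) (v t) ∈ tangentSpaceAt M (u t) := by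
    rw [hAM _ hx]
    exact tangentProj_apply_mem _ _ _
  have hDV := (h1 l u v h t).trans (le_max_right (max 1 r) C₁)
  set w := fun t => A (u t) (v t)
  have hwt : w t = A (u t) (v t) := rfl
  have hVb : ‖w t‖ ≤ b := hV.trans hbr
  rw [← hwt] at hV hVm
  set T := unitTangent u t
  set K := curvatureVector M u t
  set DV := covDeriv M u w t
  set DDV := covDeriv M u (covDeriv M u w) t
  set V := w t
  have hk := norm_nonneg K
  have hD := norm_nonneg DDV
  have hR := hc (u t) hx
  have hin : ∀ {X Y : 𝔼 q} {a b : ℝ}, ‖X‖ ≤ a → ‖Y‖ ≤ b → |⟪X, Y⟫_ℝ| ≤ a * b :=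
    fun {X Y a b} ha hb => (abs_real_inner_le_norm X Y).trans
      (mul_le_mul ha hb (norm_nonneg Y) ((norm_nonneg X).trans ha))
  have hT1 : ‖T‖ ≤ 1 := hT.le
  have hR' : ∀ {X Y Z : 𝔼 q} {a₁ a₂ a₃ : ℝ}, ‖X‖ ≤ a₁ → ‖Y‖ ≤ a₂ → ‖Z‖ ≤ a₃ →
      ‖curvature M (u t) X Y Z‖ ≤ c * a₁ * a₂ * a₃ := by
    intro X Y Z a₁ a₂ a₃ h₁ h₂ h₃
    have := (norm_nonneg X).trans h₁
    have := (norm_nonneg Y).trans h₂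
    exact (hR X Y Z).trans (by gcongr)
  have hRB : ‖curvature M (u t) V T T‖ ≤ B := (hR' hVb hT1 hT1).trans (by linarith)
  obtain ⟨e1, e2⟩ := abs_curvatureSecondVariation_terms_le (B := B) (D := ‖DDV‖) (k := ‖K‖)
    (ρ := ‖curvature M (u t) V T T‖) (n := ‖DV‖) (x := ⟪DV, T⟫_ℝ)
    (y := ⟪curvature M (u t) T V V, T⟫_ℝ) (z := ⟪DDV, T⟫_ℝ) (p := ⟪DV, K⟫_ℝ) (s := ⟪DDV, K⟫_ℝ)
    (a₁ := ⟪curvatureDeriv M (u t) T V T V, K⟫_ℝ)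
    (a₂ := ⟪curvatureDeriv M (u t) V V T T, K⟫_ℝ)
    (a₃ := ⟪curvature M (u t) DV T V, K⟫_ℝ) (a₄ := ⟪curvature M (u t) K V V, K⟫_ℝ)
    (a₅ := ⟪curvature M (u t) V T DV, K⟫_ℝ) (a₆ := ⟪curvature M (u t) V DV T, K⟫_ℝ)
    (a₇ := ⟪curvature M (u t) V T T, DDV⟫_ℝ) (a₈ := ⟪curvature M (u t) V T T, K⟫_ℝ)
    (hb1.trans hbB) hD hk
    (by rw [abs_norm]; exact hRB)
    (by rw [abs_norm]; exact hDV.trans hbB)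
    ((hin hDV hT1).trans (by linarith))
    ((hin (hR' hT1 hVb hVb) hT1).trans (by linarith))
    ((hin le_rfl hT1).trans (by linarith))
    (hin (hDV.trans hbB) le_rfl)
    (hin le_rfl le_rfl)
    (hin ((hd _ hx T hTm V T V (by simp [hT1]) (by simp [hV]) (by simp [hT1])
      (by simp [hV])).trans hdB) le_rfl)
    (hin ((hd _ hx V hVm V T T (by simp [hV]) (by simp [hV]) (by simp [hT1])
      (by simp [hT1])).trans hdB) le_rfl)
    (hin ((hR' hDV hT1 hVb).trans (by linarith)) le_rfl)
    ((hin (hR' (le_refl ‖K‖) hVb hVb) (le_refl ‖K‖)).trans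
      (le_trans (le_of_eq (by ring)) (mul_le_mul_of_nonneg_right hcB (sq_nonneg ‖K‖))))
    (hin ((hR' hVb hT1 hDV).trans (by linarith)) le_rfl)
    (hin ((hR' hVb hDV hT1).trans (by linarith)) le_rfl)
    (hin hRB le_rfl)
    (hin hRB le_rfl)
  -- The second covariant derivative is exchanged for `v''`, using `(1 + k + w)² ≤ 3 (1 + k² + w²)`.
  have hDD : 1 + ‖DDV‖ ^ 2 + ‖K‖ ^ 2 ≤
      (1 + 3 * C₂ ^ 2) * (1 + ‖K‖ ^ 2 + ‖deriv (deriv v) t‖ ^ 2) := by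
    have h5 : ‖DDV‖ ^ 2 ≤ (C₂ * (1 + ‖K‖ + ‖deriv (deriv v) t‖)) ^ 2 :=
      pow_le_pow_left₀ hD ht 2
    have h6 : (1 + ‖K‖ + ‖deriv (deriv v) t‖) ^ 2 ≤
        3 * (1 + ‖K‖ ^ 2 + ‖deriv (deriv v) t‖ ^ 2) := by
      nlinarith only [sq_nonneg (1 - ‖K‖), sq_nonneg (1 - ‖deriv (deriv v) t‖),
        sq_nonneg (‖K‖ - ‖deriv (deriv v) t‖)]
    have h7 := mul_le_mul_of_nonneg_left h6 (sq_nonneg C₂)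
    rw [mul_pow] at h5
    nlinarith only [sq_nonneg ‖deriv (deriv v) t‖, h5, h7]
  have hfin : 100 * B ^ 2 * (1 + ‖DDV‖ ^ 2 + ‖K‖ ^ 2) ≤
      100 * B ^ 2 * (1 + 3 * C₂ ^ 2) * (1 + ‖K‖ ^ 2 + ‖deriv (deriv v) t‖ ^ 2) := by
    rw [mul_assoc (100 * B ^ 2)]
    exact mul_le_mul_of_nonneg_left hDD (by positivity)
  exact ⟨e1.trans hfin, e2.trans hfin⟩

/-! ### Comparison with the second variation of length, and passage to the limit. -/

theorem intervalIntegral_eq_integral_circleMeasure (f : ℝ → ℝ) :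
    ∫ t in (0 : ℝ)..(2 * π), f t = ∫ t, f t ∂circleMeasure :=
  intervalIntegral.integral_of_le (by positivity)

/-- The second variation of length along the curve
`u` of constant speed `l`, in the direction `t ↦ A (u t) (v t)`. -/
def lengthSecondVariation (A : (𝔼 q) → (𝔼 q) →L[ℝ] (𝔼 q)) (l : ℝ) (u v : ℝ → 𝔼 q) : ℝ :=
  ∫ t, lengthIntegrand A (u t, deriv u t, l⁻¹, v t, deriv v t) * l ∂circleMeasure

section

variable {M : Set (𝔼 q)} {A : (𝔼 q) → (𝔼 q) →L[ℝ] (𝔼 q)} {r l : ℝ} {u v : ℝ → 𝔼 q}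

theorem IsBoundedPair.secondVariation_eq (h : IsBoundedPair M r l u v) (hA : ContDiff ℝ 2 A)
    (hAM : ∀ x ∈ M, A x = tangentProj M x) (σ : ℝ) :
    secondVariation M σ u (fun t => A (u t) (v t)) =
      2 * σ ^ 2 * (∫ t, curvatureSecondVariation M u (fun t => A (u t) (v t)) t * l ∂circleMeasure)
      + 4 * σ ^ 2 * (∫ t, mixedIntegrand M u (fun t => A (u t) (v t)) t * l ∂circleMeasure)
      + ∫ t, (1 + σ ^ 2 * geodesicCurvature M u t ^ 2) *
          lengthIntegrand A (u t, deriv u t, l⁻¹, v t, deriv v t) * l ∂circleMeasure := by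
  have h1 : ∀ t, ‖covDeriv M u (fun t => A (u t) (v t)) t‖ ^ 2
      - ⟪covDeriv M u (fun t => A (u t) (v t)) t, unitTangent u t⟫_ℝ ^ 2
      - ⟪curvature M (u t) (unitTangent u t) (A (u t) (v t)) (A (u t) (v t)),
          unitTangent u t⟫_ℝ = lengthIntegrand A (u t, deriv u t, l⁻¹, v t, deriv v t) := by
    intro t
    rw [h.covDeriv_eq hA hAM, h.unitTangent_eq,
      curvature_eq_curvExt hA hAM (h.isImmersion.mem t), lengthIntegrand]
  simp only [secondVariation, intervalIntegral_eq_integral_circleMeasure, h.speed, h1]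
  rfl

theorem exists_abs_lengthIntegrand_le (hM : IsCompact M) (hA : ContDiff ℝ 2 A) (r : ℝ) :
    ∃ C, 0 ≤ C ∧ ∀ l u v, IsBoundedPair M r l u v →
      ∀ t, |lengthIntegrand A (u t, deriv u t, l⁻¹, v t, deriv v t)| ≤ C := by
  have hB : IsCompact (Metric.closedBall (0 : 𝔼 q) r) := isCompact_closedBall _ _
  have hB' : IsCompact (Metric.closedBall (0 : ℝ) r) := isCompact_closedBall _ _
  obtain ⟨C, hC⟩ := (hM.prod (hB.prod (hB'.prod (hB.prod hB)))).exists_bound_of_continuousOn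
    (continuous_lengthIntegrand hA).continuousOn
  refine ⟨max C 0, le_max_right _ _, fun l u v h t => (hC _ ?_).trans (le_max_left _ _)⟩
  simp [h.isImmersion.mem t, h.speed t, h.speed_le, h.norm_le t, h.norm_deriv_le t,
    abs_of_pos h.speed_pos, h.inv_speed_le]

theorem IsBoundedPair.continuous_lengthIntegrand (h : IsBoundedPair M r l u v)
    (hA : ContDiff ℝ 2 A) :
    Continuous fun t => lengthIntegrand A (u t, deriv u t, l⁻¹, v t, deriv v t) :=
  (ViscosityGeodesic.continuous_lengthIntegrand hA).comp
    (h.isImmersion.isW22.continuous.prodMk (h.isImmersion.isW22.continuous_deriv.prodMk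
      (continuous_const.prodMk (h.isW22.continuous.prodMk h.isW22.continuous_deriv))))

theorem abs_integral_mul_const_le {f G : ℝ → ℝ} {C : ℝ} (hl : 0 ≤ l)
    (hG : Integrable G circleMeasure) (hf : ∀ᵐ t ∂circleMeasure, |f t| ≤ C * G t) :
    |∫ t, f t * l ∂circleMeasure| ≤ C * (l * ∫ t, G t ∂circleMeasure) := by
  have h1 : ‖∫ t, f t * l ∂circleMeasure‖ ≤ ∫ t, (C * l) * G t ∂circleMeasure := by
    refine norm_integral_le_of_norm_le (hG.const_mul _) ?_
    filter_upwards [hf] with t ht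
    rw [norm_mul, Real.norm_eq_abs, Real.norm_of_nonneg hl]
    calc |f t| * l ≤ C * G t * l := mul_le_mul_of_nonneg_right ht hl
      _ = _ := by ring
  rw [integral_const_mul, mul_assoc] at h1
  exact h1

/-- The second variation of `E_σ` differs from that of length by terms which are controlled by
`σ² ∫ κ²`. -/
theorem exists_abs_secondVariation_sub_le (hM : IsCompact M) (hA : ContDiff ℝ 2 A)
    (hAM : ∀ x ∈ M, A x = tangentProj M x) (r : ℝ) :
    ∃ C, 0 ≤ C ∧ ∀ (σ l : ℝ) (u v : ℝ → 𝔼 q) (g : ℝ → ℝ), IsBoundedPair M r l u v →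
      Integrable g circleMeasure → (∀ᵐ t ∂circleMeasure, ‖deriv (deriv v) t‖ ^ 2 ≤ g t) →
      |secondVariation M σ u (fun t => A (u t) (v t)) - lengthSecondVariation A l u v| ≤
        C * (σ ^ 2 * (l * (2 * π + ∫ t, g t ∂circleMeasure)) +
          σ ^ 2 * (∫ t in (0 : ℝ)..(2 * π), geodesicCurvature M u t ^ 2 * ‖deriv u t‖)) := by
  obtain ⟨C₁, hC₁, h1⟩ := exists_abs_curvatureSecondVariation_le hM hA hAM r
  obtain ⟨C₂, hC₂, h2⟩ := exists_abs_lengthIntegrand_le (M := M) hM hA r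
  -- The prefactors `2 σ²` and `4 σ²` of the first two integrals give `6 C₁`; `C₂` comes from the
  -- weight `σ² κ²` on the length integrand.
  refine ⟨6 * C₁ + C₂, by positivity, fun σ l u v g h hg hgv => ?_⟩
  have hl := h.speed_pos.le
  have hκ := h.integrable_geodesicCurvature_sq hA hAM
  have hG₁ : Integrable (fun t => 1 + geodesicCurvature M u t ^ 2) circleMeasure :=
    (integrable_const 1).add hκ
  have hG : Integrable (fun t => 1 + geodesicCurvature M u t ^ 2 + g t) circleMeasure :=
    hG₁.add hg
  have hJ : ∫ t, (1 + geodesicCurvature M u t ^ 2 + g t) ∂circleMeasure =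
      2 * π + ∫ t, g t ∂circleMeasure + ∫ t, geodesicCurvature M u t ^ 2 ∂circleMeasure := by
    rw [integral_add hG₁ hg, integral_add (integrable_const 1) hκ]
    simp [Real.pi_pos.le]
    ring
  have hg0 : 0 ≤ ∫ t, g t ∂circleMeasure := by
    refine integral_nonneg_of_ae ?_
    filter_upwards [hgv] with t ht
    exact (sq_nonneg _).trans ht
  have hκ0 : 0 ≤ ∫ t, geodesicCurvature M u t ^ 2 ∂circleMeasure :=
    integral_nonneg fun t => sq_nonneg _
  have hb : ∀ᵐ t ∂circleMeasure,
      |curvatureSecondVariation M u (fun t => A (u t) (v t)) t| ≤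
        C₁ * (1 + geodesicCurvature M u t ^ 2 + g t) ∧
      |mixedIntegrand M u (fun t => A (u t) (v t)) t| ≤
        C₁ * (1 + geodesicCurvature M u t ^ 2 + g t) := by
    filter_upwards [h1 l u v h, hgv] with t ht hgt
    have := mul_le_mul_of_nonneg_left hgt hC₁
    constructor
    · linarith [ht.1]
    · linarith [ht.2]
  have e1 := abs_integral_mul_const_le hl hG (hb.mono fun t ht => ht.1)
  have e2 := abs_integral_mul_const_le hl hG (hb.mono fun t ht => ht.2)
  have hcont := h.continuous_lengthIntegrand hA
  set f := fun t => lengthIntegrand A (u t, deriv u t, l⁻¹, v t, deriv v t)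
  have hfi : Integrable (fun t => f t * l) circleMeasure :=
    (memLp_of_continuous (p := 1) (hcont.mul continuous_const)).integrable le_rfl
  have hfκ : Integrable (fun t => geodesicCurvature M u t ^ 2 * f t) circleMeasure :=
    hκ.mul_bdd (c := C₂) hcont.aestronglyMeasurable (Eventually.of_forall fun t => h2 l u v h t)
  have e3 : |∫ t, geodesicCurvature M u t ^ 2 * f t * l ∂circleMeasure| ≤
      C₂ * (l * ∫ t, geodesicCurvature M u t ^ 2 ∂circleMeasure) := by
    refine abs_integral_mul_const_le hl hκ (Eventually.of_forall fun t => ?_)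
    rw [abs_mul, abs_of_nonneg (sq_nonneg _), mul_comm]
    exact mul_le_mul_of_nonneg_right (h2 l u v h t) (sq_nonneg _)
  have e4 : ∫ t, (1 + σ ^ 2 * geodesicCurvature M u t ^ 2) * f t * l ∂circleMeasure =
      lengthSecondVariation A l u v +
        σ ^ 2 * ∫ t, geodesicCurvature M u t ^ 2 * f t * l ∂circleMeasure := by
    rw [lengthSecondVariation, ← integral_const_mul,
      ← integral_add hfi ((hfκ.mul_const l).const_mul (σ ^ 2))]
    congr 1
    funext t
    ring
  rw [h.secondVariation_eq hA hAM, e4, intervalIntegral_eq_integral_circleMeasure]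
  simp only [h.speed]
  have e6 : ∫ t, geodesicCurvature M u t ^ 2 * l ∂circleMeasure =
      (∫ t, geodesicCurvature M u t ^ 2 ∂circleMeasure) * l := integral_mul_const _ _
  rw [e6]
  rw [hJ] at e1 e2
  set X := ∫ t, curvatureSecondVariation M u (fun t => A (u t) (v t)) t * l ∂circleMeasure
  set Y := ∫ t, mixedIntegrand M u (fun t => A (u t) (v t)) t * l ∂circleMeasure
  set Z := ∫ t, geodesicCurvature M u t ^ 2 * f t * l ∂circleMeasure
  set κ := ∫ t, geodesicCurvature M u t ^ 2 ∂circleMeasure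
  set G := ∫ t, g t ∂circleMeasure
  have hσ := sq_nonneg σ
  have e5 : |2 * X + 4 * Y + Z| ≤ (6 * C₁ + C₂) * (l * (2 * π + G) + κ * l) := by
    have h6 : C₂ * (l * κ) ≤ C₂ * (l * (2 * π + G + κ)) := by
      have : 0 ≤ 2 * π + G := by positivity
      gcongr
      linarith
    calc |2 * X + 4 * Y + Z| ≤ |2 * X| + |4 * Y| + |Z| := abs_add_three _ _ _
      _ = 2 * |X| + 4 * |Y| + |Z| := by rw [abs_mul, abs_mul]; norm_num
      _ ≤ 2 * (C₁ * (l * (2 * π + G + κ))) + 4 * (C₁ * (l * (2 * π + G + κ)))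
          + C₂ * (l * (2 * π + G + κ)) := by linarith
      _ = _ := by ring
  calc _ = |σ ^ 2 * (2 * X + 4 * Y + Z)| := by congr 1; ring
    _ = σ ^ 2 * |2 * X + 4 * Y + Z| := by rw [abs_mul, abs_of_nonneg hσ]
    _ ≤ σ ^ 2 * ((6 * C₁ + C₂) * (l * (2 * π + G) + κ * l)) := by gcongr
    _ = _ := by ring

/-- The integrand is continuous in first-order data alone and uniformly bounded, so dominated
convergence applies without any control on second derivatives. -/
theorem tendsto_lengthSecondVariation (hM : IsCompact M) (hA : ContDiff ℝ 2 A)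
    {l : ℕ → ℝ} {u v : ℕ → ℝ → 𝔼 q}
    {l₀ : ℝ} {u₀ v₀ : ℝ → 𝔼 q} (h : ∀ n, IsBoundedPair M r (l n) (u n) (v n)) (hl₀ : 0 < l₀)
    (hl : Tendsto l atTop (𝓝 l₀))
    (hu : ∀ᵐ t ∂circleMeasure, Tendsto (fun n => u n t) atTop (𝓝 (u₀ t)))
    (hu' : ∀ᵐ t ∂circleMeasure, Tendsto (fun n => deriv (u n) t) atTop (𝓝 (deriv u₀ t)))
    (hv : ∀ t, Tendsto (fun n => v n t) atTop (𝓝 (v₀ t)))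
    (hv' : ∀ t, Tendsto (fun n => deriv (v n) t) atTop (𝓝 (deriv v₀ t))) :
    Tendsto (fun n => lengthSecondVariation A (l n) (u n) (v n)) atTop
      (𝓝 (lengthSecondVariation A l₀ u₀ v₀)) := by
  obtain ⟨C, hC, h2⟩ := exists_abs_lengthIntegrand_le (M := M) hM hA r
  refine tendsto_integral_of_dominated_convergence (fun _ => C * r) ?_ (integrable_const _) ?_ ?_
  · intro n
    exact (((h n).continuous_lengthIntegrand hA).mul continuous_const).aestronglyMeasurable
  · intro n
    refine Eventually.of_forall fun t => ?_
    rw [norm_mul, Real.norm_of_nonneg (h n).speed_pos.le]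
    exact mul_le_mul (h2 _ _ _ (h n) t) (h n).speed_le (h n).speed_pos.le hC
  · filter_upwards [hu, hu'] with t ht ht'
    exact (((continuous_lengthIntegrand hA).tendsto _).comp
      (ht.prodMk_nhds (ht'.prodMk_nhds ((hl.inv₀ hl₀.ne').prodMk_nhds
        ((hv t).prodMk_nhds (hv' t)))))).mul hl

theorem tendsto_secondVariation (hM : IsCompact M) (hA : ContDiff ℝ 2 A)
    (hAM : ∀ x ∈ M, A x = tangentProj M x) {σ l : ℕ → ℝ} {u v : ℕ → ℝ → 𝔼 q}
    {l₀ : ℝ} {u₀ v₀ : ℝ → 𝔼 q} {g : ℝ → ℝ} (h : ∀ n, IsBoundedPair M r (l n) (u n) (v n))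
    (h₀ : IsBoundedPair M r l₀ u₀ v₀) (hσ : Tendsto σ atTop (𝓝 0))
    (hentropy : Tendsto (fun n => σ n ^ 2 *
      ∫ t in (0 : ℝ)..(2 * π), geodesicCurvature M (u n) t ^ 2 * ‖deriv (u n) t‖) atTop (𝓝 0))
    (hg : Integrable g circleMeasure)
    (hgv : ∀ n, ∀ᵐ t ∂circleMeasure, ‖deriv (deriv (v n)) t‖ ^ 2 ≤ g t)
    (hl : Tendsto l atTop (𝓝 l₀))
    (hu : ∀ᵐ t ∂circleMeasure, Tendsto (fun n => u n t) atTop (𝓝 (u₀ t)))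
    (hu' : ∀ᵐ t ∂circleMeasure, Tendsto (fun n => deriv (u n) t) atTop (𝓝 (deriv u₀ t)))
    (hv : ∀ t, Tendsto (fun n => v n t) atTop (𝓝 (v₀ t)))
    (hv' : ∀ t, Tendsto (fun n => deriv (v n) t) atTop (𝓝 (deriv v₀ t))) :
    Tendsto (fun n => secondVariation M (σ n) (u n) (fun t => A (u n t) (v n t))) atTop
      (𝓝 (secondVariation M 0 u₀ (fun t => A (u₀ t) (v₀ t)))) := by
  obtain ⟨C, hC, h1⟩ := exists_abs_secondVariation_sub_le hM hA hAM r
  have hlim : secondVariation M 0 u₀ (fun t => A (u₀ t) (v₀ t)) =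
      lengthSecondVariation A l₀ u₀ v₀ := by
    -- For `σ = 0` the right-hand side of the comparison estimate vanishes, which identifies the two
    -- forms at the limit curve.
    have h2 := h1 0 l₀ u₀ v₀ _ h₀ (h₀.isW22.memLp_deriv_deriv.integrable_norm_pow two_ne_zero)
      (Eventually.of_forall fun t => le_rfl)
    simp only [ne_eq, OfNat.ofNat_ne_zero, not_false_eq_true, zero_pow, zero_mul, add_zero,
      mul_zero] at h2
    exact sub_eq_zero.mp (abs_nonpos_iff.mp h2)
  rw [hlim]
  have h3 := tendsto_lengthSecondVariation hM hA h h₀.speed_pos hl hu hu' hv hv'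
  have h4 : Tendsto (fun n => secondVariation M (σ n) (u n) (fun t => A (u n t) (v n t)) -
      lengthSecondVariation A (l n) (u n) (v n)) atTop (𝓝 0) := by
    refine squeeze_zero_norm (fun n => h1 (σ n) (l n) (u n) (v n) g (h n) hg (hgv n)) ?_
    have h5 := (((hσ.pow 2).mul (hl.mul_const (2 * π + ∫ t, g t ∂circleMeasure))).add
      hentropy).const_mul C
    simpa using h5
  simpa using h4.add h3

end

/-! ### Quadratic homogeneity of the second variation. -/

section Homogeneity

variable {M : Set (𝔼 q)} {A : (𝔼 q) → (𝔼 q) →L[ℝ] (𝔼 q)}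

theorem covDeriv_smul (M : Set (𝔼 q)) (u w : ℝ → 𝔼 q) (c : ℝ) :
    covDeriv M u (c • w) = c • covDeriv M u w := by
  funext t
  rw [Pi.smul_apply, covDeriv, covDeriv, deriv_const_smul_field, map_smul, smul_comm]

theorem curvature_smul (hA : ContDiff ℝ 2 A) (hAM : ∀ x ∈ M, A x = tangentProj M x) {x : 𝔼 q}
    (hx : x ∈ M) (a b c : ℝ) (X Y Z : 𝔼 q) :
    curvature M x (a • X) (b • Y) (c • Z) = (a * b * c) • curvature M x X Y Z := by
  rw [curvature_eq_curvExt hA hAM hx, curvature_eq_curvExt hA hAM hx, curvExt_smul]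

theorem curvatureDeriv_smul (hA : ContDiff ℝ 2 A) (hAM : ∀ x ∈ M, A x = tangentProj M x)
    {x W : 𝔼 q} (hx : x ∈ M) (hW : W ∈ tangentSpaceAt M x) (d a b c : ℝ) (X Y Z : 𝔼 q) :
    curvatureDeriv M x (d • W) (a • X) (b • Y) (c • Z) =
      (d * a * b * c) • curvatureDeriv M x W X Y Z := by
  rw [curvatureDeriv_eq_curvDerivExt hA hAM hx hW,
    curvatureDeriv_eq_curvDerivExt hA hAM hx (Submodule.smul_mem _ _ hW), curvDerivExt_smul hA]

/-- Each integrand has degree two in the field. Tangency is needed for the term in which the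
curvature tensor is differentiated in the direction of the field, since only tangential derivatives
are intrinsic to `M`. -/
theorem secondVariation_smul (hA : ContDiff ℝ 2 A) (hAM : ∀ x ∈ M, A x = tangentProj M x)
    {u w : ℝ → 𝔼 q} (hu : IsImmersion M u) (hw : ∀ t, w t ∈ tangentSpaceAt M (u t)) (σ c : ℝ) :
    secondVariation M σ u (c • w) = c ^ 2 * secondVariation M σ u w := by
  have hR := fun t => curvature_smul hA hAM (hu.mem t)
  have hR₁ : ∀ t X Y Z, curvature M (u t) (c • X) Y Z = c • curvature M (u t) X Y Z :=
    fun t X Y Z => by simpa using hR t c 1 1 X Y Z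
  have hR₂ : ∀ t X Y Z, curvature M (u t) X (c • Y) Z = c • curvature M (u t) X Y Z :=
    fun t X Y Z => by simpa using hR t 1 c 1 X Y Z
  have hR₃ : ∀ t X Y Z, curvature M (u t) X Y (c • Z) = c • curvature M (u t) X Y Z :=
    fun t X Y Z => by simpa using hR t 1 1 c X Y Z
  have hT : ∀ t, unitTangent u t ∈ tangentSpaceAt M (u t) := fun t =>
    Submodule.smul_mem _ _ (hu.deriv_mem_tangentSpaceAt t)
  have hD₁ : ∀ t X Y Z, curvatureDeriv M (u t) (unitTangent u t) (c • X) Y (c • Z) =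
      (c * c) • curvatureDeriv M (u t) (unitTangent u t) X Y Z := fun t X Y Z => by
    simpa using curvatureDeriv_smul hA hAM (hu.mem t) (hT t) 1 c 1 c X Y Z
  have hD₂ : ∀ t X Y Z, curvatureDeriv M (u t) (c • w t) (c • X) Y Z =
      (c * c) • curvatureDeriv M (u t) (w t) X Y Z := fun t X Y Z => by
    simpa using curvatureDeriv_smul hA hAM (hu.mem t) (hw t) c c 1 1 X Y Z
  have h1 : ∀ t, curvatureSecondVariation M u (c • w) t * ‖deriv u t‖ =
      c ^ 2 * (curvatureSecondVariation M u w t * ‖deriv u t‖) := by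
    intro t
    simp only [curvatureSecondVariation, covDeriv_smul, Pi.smul_apply, hR₁, hR₂, hR₃, hD₁, hD₂,
      real_inner_smul_left, real_inner_smul_right, norm_smul, mul_pow, Real.norm_eq_abs, sq_abs]
    ring
  have h2 : ∀ t, mixedIntegrand M u (c • w) t * ‖deriv u t‖ =
      c ^ 2 * (mixedIntegrand M u w t * ‖deriv u t‖) := by
    intro t
    simp only [mixedIntegrand, covDeriv_smul, Pi.smul_apply, hR₁, real_inner_smul_left]
    ring
  have h3 : ∀ t, (1 + σ ^ 2 * geodesicCurvature M u t ^ 2) *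
      (‖covDeriv M u (c • w) t‖ ^ 2 - ⟪covDeriv M u (c • w) t, unitTangent u t⟫_ℝ ^ 2
        - ⟪curvature M (u t) (unitTangent u t) ((c • w) t) ((c • w) t), unitTangent u t⟫_ℝ)
      * ‖deriv u t‖ = c ^ 2 * ((1 + σ ^ 2 * geodesicCurvature M u t ^ 2) *
      (‖covDeriv M u w t‖ ^ 2 - ⟪covDeriv M u w t, unitTangent u t⟫_ℝ ^ 2
        - ⟪curvature M (u t) (unitTangent u t) (w t) (w t), unitTangent u t⟫_ℝ)
      * ‖deriv u t‖) := by
    intro t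
    simp only [covDeriv_smul, Pi.smul_apply, hR₂, hR₃, real_inner_smul_left, norm_smul, mul_pow,
      Real.norm_eq_abs, sq_abs]
    ring
  simp only [mixedIntegrand] at h2
  simp only [secondVariation, h1, h2, h3, intervalIntegral.integral_const_mul]
  ring

end Homogeneity

/-! ### Test spaces, limiting speeds and finite linear families. -/

theorem IsW22.exists_bound {f : ℝ → 𝔼 q} (hf : IsW22 f) :
    ∃ C, ∀ t, ‖f t‖ ≤ C ∧ ‖deriv f t‖ ≤ C := by
  have h : ∀ {g : ℝ → 𝔼 q}, Function.Periodic g (2 * π) → Continuous g → ∃ C, ∀ t, ‖g t‖ ≤ C := by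
    intro g hg hgc
    obtain ⟨C, hC⟩ := (hg.compact_of_continuous (by positivity) hgc).isBounded.exists_norm_le
    exact ⟨C, fun t => hC _ (mem_range_self t)⟩
  obtain ⟨C₁, h1⟩ := h hf.periodic hf.continuous
  have hper : Function.Periodic (deriv f) (2 * π) := fun t => by
    rw [← deriv_comp_add_const, hf.periodic.funext]
  obtain ⟨C₂, h2⟩ := h hper hf.continuous_deriv
  exact ⟨max C₁ C₂, fun t => ⟨(h1 t).trans (le_max_left _ _), (h2 t).trans (le_max_right _ _)⟩⟩

/-- Pointwise application of `A (u t)` to vector fields. -/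
def applyAlong (A : (𝔼 q) → (𝔼 q) →L[ℝ] (𝔼 q)) (u : ℝ → 𝔼 q) :
    (ℝ → 𝔼 q) →ₗ[ℝ] (ℝ → 𝔼 q) where
  toFun v t := A (u t) (v t)
  map_add' v w := funext fun t => map_add (A (u t)) (v t) (w t)
  map_smul' c v := funext fun t => map_smul (A (u t)) c (v t)

theorem applyAlong_mem_fieldsAlong {M : Set (𝔼 q)} {A : (𝔼 q) → (𝔼 q) →L[ℝ] (𝔼 q)}
    (hA : ContDiff ℝ 2 A) (hAM : ∀ x ∈ M, A x = tangentProj M x) {u v : ℝ → 𝔼 q}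
    (hu : IsImmersion M u) (hv : IsW22 v) : applyAlong A u v ∈ fieldsAlong M u :=
  ⟨hu.isW22.clm_comp_apply hA hv, fun t => by
    change A (u t) (v t) ∈ _
    rw [hAM _ (hu.mem t)]
    exact tangentProj_apply_mem _ _ _⟩

/-- A linear family of fields on which the second variation is negative definite bounds the index
from below. -/
theorem natCast_le_index {M : Set (𝔼 q)} {A : (𝔼 q) → (𝔼 q) →L[ℝ] (𝔼 q)}
    (hA : ContDiff ℝ 2 A) (hAM : ∀ x ∈ M, A x = tangentProj M x) {σ : ℝ} {u : ℝ → 𝔼 q}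
    (hu : IsImmersion M u) {k : ℕ} (S : (Fin k → ℝ) →ₗ[ℝ] (ℝ → 𝔼 q))
    (hS : ∀ c, S c ∈ fieldsAlong M u) (hneg : ∀ c, ‖c‖ = 1 → secondVariation M σ u (S c) < 0) :
    (k : ℕ∞) ≤ index M σ u := by
  have hhom : ∀ (a : ℝ) c, secondVariation M σ u (S (a • c)) =
      a ^ 2 * secondVariation M σ u (S c) := fun a c => by
    rw [map_smul, secondVariation_smul hA hAM hu (hS c).2]
  have hneg' : ∀ c, c ≠ 0 → secondVariation M σ u (S c) < 0 := by
    intro c hc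
    have hc' : ‖c‖ ≠ 0 := norm_ne_zero_iff.mpr hc
    have h1 := hneg (‖c‖⁻¹ • c) (by rw [norm_smul, norm_inv, norm_norm, inv_mul_cancel₀ hc'])
    rw [hhom] at h1
    exact neg_of_mul_neg_right h1 (sq_nonneg _)
  -- The zero field has second variation zero by homogeneity, so a nonzero `c` with `S c = 0` would
  -- contradict negativity.
  have hinj : Function.Injective S := by
    rw [← LinearMap.ker_eq_bot, LinearMap.ker_eq_bot']
    intro c hc
    by_contra hc0
    have h1 := hneg' c hc0
    have h2 := hhom 0 0
    rw [smul_zero, map_zero] at h2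
    rw [hc, h2] at h1
    simp at h1
  have hN : IsNegDefOn M σ u (LinearMap.range S) := by
    refine ⟨?_, ?_⟩
    · rintro _ ⟨c, rfl⟩
      exact hS c
    · rintro _ ⟨c, rfl⟩ hc
      exact hneg' c fun h => hc (by rw [h, map_zero])
  have hrank : Module.rank ℝ (LinearMap.range S) = k := by
    rw [rank_range_of_injective S hinj]
    simp
  calc (k : ℕ∞) = Cardinal.toENat (Module.rank ℝ (LinearMap.range S)) := by rw [hrank]; simp
    _ ≤ _ := le_iSup (fun V : {V : Submodule ℝ (ℝ → 𝔼 q) // IsNegDefOn M σ u V} =>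
      Cardinal.toENat (Module.rank ℝ V.1)) ⟨_, hN⟩

/-- Curves of constant speed whose velocities converge almost everywhere to that of an immersion
have speeds which converge to a positive limit, the constant speed of the limit curve. -/
theorem exists_tendsto_speed {u : ℕ → ℝ → 𝔼 q} {u₀ : ℝ → 𝔼 q}
    (hspeed : ∀ n s t, ‖deriv (u n) s‖ = ‖deriv (u n) t‖) (hu₀ : Continuous (deriv u₀))
    (hderiv : ∀ᵐ t, Tendsto (fun n => deriv (u n) t) atTop (𝓝 (deriv u₀ t))) :
    ∃ l₀, (∀ t, ‖deriv u₀ t‖ = l₀) ∧ Tendsto (fun n => ‖deriv (u n) 0‖) atTop (𝓝 l₀) := by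
  have h1 : ∀ᵐ t, Tendsto (fun n => ‖deriv (u n) 0‖) atTop (𝓝 ‖deriv u₀ t‖) := by
    filter_upwards [hderiv] with t ht
    refine ht.norm.congr fun n => hspeed n t 0
  obtain ⟨t₀, ht₀⟩ := h1.exists
  refine ⟨‖deriv u₀ t₀‖, ?_, ht₀⟩
  -- Uniqueness of limits makes the limiting speed constant almost everywhere, and continuity of
  -- `deriv u₀` makes it constant everywhere.
  have h2 : (fun t => ‖deriv u₀ t‖) =ᵐ[volume] fun _ => ‖deriv u₀ t₀‖ := by
    filter_upwards [h1] with t ht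
    exact tendsto_nhds_unique ht ht₀
  exact fun t => congrFun ((hu₀.norm.ae_eq_iff_eq volume continuous_const).mp h2) t

section LinearFamily

variable {k : ℕ} {e : Fin k → ℝ → 𝔼 q}

theorem linearCombination_apply (c : Fin k → ℝ) (t : ℝ) :
    Fintype.linearCombination ℝ e c t = ∑ i, c i • e i t := by
  rw [Fintype.linearCombination_apply, Finset.sum_apply]
  rfl

theorem deriv_linearCombination (he : ∀ i, IsW22 (e i)) (c : Fin k → ℝ) (t : ℝ) :
    deriv (Fintype.linearCombination ℝ e c) t = ∑ i, c i • deriv (e i) t := by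
  rw [funext (linearCombination_apply c)]
  exact (HasDerivAt.fun_sum fun i _ => ((he i).differentiable t).hasDerivAt.const_smul (c i)).deriv

theorem ae_deriv_deriv_linearCombination (he : ∀ i, IsW22 (e i)) (c : Fin k → ℝ) :
    ∀ᵐ t ∂circleMeasure, deriv (deriv (Fintype.linearCombination ℝ e c)) t =
      ∑ i, c i • deriv (deriv (e i)) t := by
  have h : ∀ᵐ t ∂circleMeasure, ∀ i, HasDerivAt (deriv (e i)) (deriv (deriv (e i)) t) t :=
    ae_all_iff.mpr fun i => (he i).ae_hasDerivAt
  filter_upwards [h] with t ht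
  rw [funext (deriv_linearCombination he c)]
  exact (HasDerivAt.fun_sum fun i _ => (ht i).const_smul (c i)).deriv

/-- Coefficients carry the supremum norm, so each has absolute value at most one. The resulting
bound does not depend on `c`. -/
theorem norm_sum_smul_le {F : Type*} [NormedAddCommGroup F] [NormedSpace ℝ F] {c : Fin k → ℝ}
    (hc : ‖c‖ ≤ 1) (f : Fin k → F) : ‖∑ i, c i • f i‖ ≤ ∑ i, ‖f i‖ := by
  refine norm_sum_le_of_le _ fun i _ => ?_
  rw [norm_smul]
  exact mul_le_of_le_one_left (norm_nonneg _) ((norm_le_pi_norm c i).trans hc)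

end LinearFamily

/-! ### Semicontinuity of the index. -/

/-- Uniformity in `c` comes from compactness of the unit sphere. If negativity failed for infinitely
many `n`, the offending coefficients would converge along a subsequence to some unit `c₀`, and
convergence of the second variations would give a nonnegative value at `c₀`. -/
theorem eventually_secondVariation_neg {M : Set (𝔼 q)} {A : (𝔼 q) → (𝔼 q) →L[ℝ] (𝔼 q)}
    (hM : IsCompact M) (hA : ContDiff ℝ 2 A) (hAM : ∀ x ∈ M, A x = tangentProj M x)
    {σ : ℕ → ℝ} (hσ : Tendsto σ atTop (𝓝 0)) {u : ℕ → ℝ → 𝔼 q} (hu : ∀ n, IsImmersion M (u n))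
    (hu_speed : ∀ n s t, ‖deriv (u n) s‖ = ‖deriv (u n) t‖)
    (hu_entropy : Tendsto (fun n => σ n ^ 2 *
      ∫ t in (0 : ℝ)..(2 * π), geodesicCurvature M (u n) t ^ 2 * ‖deriv (u n) t‖) atTop (𝓝 0))
    {u₀ : ℝ → 𝔼 q} (hu₀ : IsImmersion M u₀)
    (hu_lim : ∀ᵐ t, Tendsto (fun n => u n t) atTop (𝓝 (u₀ t)))
    (hu_deriv : ∀ᵐ t, Tendsto (fun n => deriv (u n) t) atTop (𝓝 (deriv u₀ t)))
    {k : ℕ} {e : Fin k → ℝ → 𝔼 q} (he : ∀ i, e i ∈ fieldsAlong M u₀)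
    (hneg : ∀ c, ‖c‖ = 1 → secondVariation M 0 u₀ (Fintype.linearCombination ℝ e c) < 0) :
    ∀ᶠ n in atTop, ∀ c, ‖c‖ = 1 →
      secondVariation M (σ n) (u n) (applyAlong A (u n) (Fintype.linearCombination ℝ e c)) < 0 := by
  have heW : ∀ i, IsW22 (e i) := fun i => (he i).1
  have hLmem : ∀ c, Fintype.linearCombination ℝ e c ∈ fieldsAlong M u₀ := fun c => by
    rw [Fintype.linearCombination_apply]
    exact Submodule.sum_mem _ fun i _ => Submodule.smul_mem _ _ (he i)
  obtain ⟨l₀, hl₀, hl⟩ := exists_tendsto_speed hu_speed hu₀.isW22.continuous_deriv hu_deriv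
  have hl₀pos : 0 < l₀ := by
    rw [← hl₀ 0]
    exact norm_pos_iff.mpr (hu₀.deriv_ne_zero 0)
  obtain ⟨r₁, hr₁⟩ := hl.bddAbove_range
  obtain ⟨r₂, hr₂⟩ := (hl.inv₀ hl₀pos.ne').bddAbove_range
  choose b hb using fun i => (heW i).exists_bound
  set r := max (max r₁ r₂) (∑ i, b i)
  have hl_le : ∀ n, ‖deriv (u n) 0‖ ≤ r := fun n =>
    (hr₁ (mem_range_self n)).trans ((le_max_left _ _).trans (le_max_left _ _))
  have hl_inv_le : ∀ n, ‖deriv (u n) 0‖⁻¹ ≤ r := fun n =>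
    (hr₂ (mem_range_self n)).trans ((le_max_right _ _).trans (le_max_left _ _))
  have hb₀ : ∀ c : Fin k → ℝ, ‖c‖ ≤ 1 → ∀ t, ‖Fintype.linearCombination ℝ e c t‖ ≤ r := by
    intro c hc t
    rw [linearCombination_apply]
    exact (norm_sum_smul_le hc _).trans
      ((Finset.sum_le_sum fun i _ => (hb i t).1).trans (le_max_right _ _))
  have hb₁ : ∀ c : Fin k → ℝ, ‖c‖ ≤ 1 → ∀ t, ‖deriv (Fintype.linearCombination ℝ e c) t‖ ≤ r := by
    intro c hc t
    rw [deriv_linearCombination heW]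
    exact (norm_sum_smul_le hc _).trans
      ((Finset.sum_le_sum fun i _ => (hb i t).2).trans (le_max_right _ _))
  have hpair : ∀ n (c : Fin k → ℝ), ‖c‖ ≤ 1 →
      IsBoundedPair M r ‖deriv (u n) 0‖ (u n) (Fintype.linearCombination ℝ e c) := fun n c hc =>
    ⟨hu n, fun t => hu_speed n t 0, hl_le n, hl_inv_le n, (hLmem c).1, hb₀ c hc, hb₁ c hc⟩
  have hpair₀ : ∀ c : Fin k → ℝ, ‖c‖ ≤ 1 →
      IsBoundedPair M r l₀ u₀ (Fintype.linearCombination ℝ e c) := fun c hc =>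
    ⟨hu₀, hl₀, le_of_tendsto' hl hl_le, le_of_tendsto' (hl.inv₀ hl₀pos.ne') hl_inv_le,
      (hLmem c).1, hb₀ c hc, hb₁ c hc⟩
  -- This single function dominates `|v''|²` for all combinations with coefficients of norm at most
  -- one, so the comparison estimate is uniform along the sequence `c`.
  have hg : Integrable (fun t => (∑ i, ‖deriv (deriv (e i)) t‖) ^ 2) circleMeasure :=
    (memLp_finsetSum Finset.univ fun i _ => (heW i).memLp_deriv_deriv.norm).integrable_sq
  by_contra hcon
  rw [not_eventually] at hcon
  obtain ⟨φ, hφ, hφc⟩ := extraction_of_frequently_atTop hcon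
  push Not at hφc
  choose c hc hcQ using hφc
  obtain ⟨c₀, hc₀, ψ, hψ, hlim⟩ := (isCompact_sphere (0 : Fin k → ℝ) 1).tendsto_subseq
    (x := c) fun n => by simp [hc n]
  have hc₀' : ‖c₀‖ = 1 := by simpa using hc₀
  have hsub : Tendsto (fun n => φ (ψ n)) atTop atTop :=
    hφ.tendsto_atTop.comp hψ.tendsto_atTop
  have hci : ∀ i, Tendsto (fun n => c (ψ n) i) atTop (𝓝 (c₀ i)) := fun i =>
    (continuous_apply i).continuousAt.tendsto.comp hlim
  have key := tendsto_secondVariation (r := r) hM hA hAM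
    (fun n => hpair (φ (ψ n)) (c (ψ n)) (hc _).le)
    (hpair₀ c₀ hc₀'.le) (hσ.comp hsub) (hu_entropy.comp hsub) hg
    (fun n => by
      filter_upwards [ae_deriv_deriv_linearCombination heW (c (ψ n))] with t ht
      rw [ht]
      exact pow_le_pow_left₀ (norm_nonneg _) (norm_sum_smul_le (hc _).le _) 2)
    (hl.comp hsub)
    (ae_restrict_of_ae (hu_lim.mono fun t ht => ht.comp hsub))
    (ae_restrict_of_ae (hu_deriv.mono fun t ht => ht.comp hsub))
    (fun t => by
      simp only [linearCombination_apply]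
      exact tendsto_finsetSum _ fun i _ => (hci i).smul_const _)
    (fun t => by
      simp only [deriv_linearCombination heW]
      exact tendsto_finsetSum _ fun i _ => (hci i).smul_const _)
  -- Along the limit curve the fields are already tangent, so the projection leaves them unchanged.
  have hA₀ : (fun t => A (u₀ t) (Fintype.linearCombination ℝ e c₀ t)) =
      Fintype.linearCombination ℝ e c₀ := by
    funext t
    rw [hAM _ (hu₀.mem t), tangentProj_apply_of_mem ((hLmem c₀).2 t)]
  rw [hA₀] at key
  exact absurd (ge_of_tendsto' key fun n => hcQ (ψ n)) (not_le.mpr (hneg c₀ hc₀'))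

theorem index_le_liminf {M : Set (𝔼 q)} {A : (𝔼 q) → (𝔼 q) →L[ℝ] (𝔼 q)}
    (hM : IsCompact M) (hA : ContDiff ℝ 2 A) (hAM : ∀ x ∈ M, A x = tangentProj M x)
    {σ : ℕ → ℝ} (hσ : Tendsto σ atTop (𝓝 0)) {u : ℕ → ℝ → 𝔼 q} (hu : ∀ n, IsImmersion M (u n))
    (hu_speed : ∀ n s t, ‖deriv (u n) s‖ = ‖deriv (u n) t‖)
    (hu_entropy : Tendsto (fun n => σ n ^ 2 *
      ∫ t in (0 : ℝ)..(2 * π), geodesicCurvature M (u n) t ^ 2 * ‖deriv (u n) t‖) atTop (𝓝 0))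
    {u₀ : ℝ → 𝔼 q} (hu₀ : IsImmersion M u₀)
    (hu_lim : ∀ᵐ t, Tendsto (fun n => u n t) atTop (𝓝 (u₀ t)))
    (hu_deriv : ∀ᵐ t, Tendsto (fun n => deriv (u n) t) atTop (𝓝 (deriv u₀ t))) :
    index M 0 u₀ ≤ liminf (fun n => index M (σ n) (u n)) atTop := by
  -- Testing against natural numbers `k` below the dimension of `V` treats finite and infinite index
  -- alike.
  refine iSup_le fun ⟨V, hV⟩ => ENat.forall_natCast_le_iff_le.mp fun k hk => ?_
  rw [Cardinal.natCast_le_toENat, Module.le_rank_iff] at hk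
  obtain ⟨e, he⟩ := hk
  have he' : LinearIndependent ℝ fun i => (e i : ℝ → 𝔼 q) :=
    he.map' V.subtype (Submodule.ker_subtype V)
  have hmem : ∀ i, (e i : ℝ → 𝔼 q) ∈ fieldsAlong M u₀ := fun i => hV.1 (e i).2
  have hneg : ∀ c : Fin k → ℝ, ‖c‖ = 1 →
      secondVariation M 0 u₀ (Fintype.linearCombination ℝ (fun i => (e i : ℝ → 𝔼 q)) c) < 0 := by
    intro c hc
    refine hV.2 _ ?_ fun h0 => ?_
    · rw [Fintype.linearCombination_apply]
      exact Submodule.sum_mem _ fun i _ => Submodule.smul_mem _ _ (e i).2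
    -- Independence of the chosen vectors ensures that a unit coefficient vector yields a nonzero
    -- field, as negative definiteness requires.
    · have : c = 0 := he'.fintypeLinearCombination_injective (by rw [h0, map_zero])
      rw [this, norm_zero] at hc
      exact zero_ne_one hc
  refine le_liminf_of_le (by isBoundedDefault) ?_
  filter_upwards [eventually_secondVariation_neg hM hA hAM hσ hu hu_speed hu_entropy hu₀ hu_lim
    hu_deriv hmem hneg] with n hn
  refine natCast_le_index hA hAM (hu n)
    (applyAlong A (u n) ∘ₗ Fintype.linearCombination ℝ fun i => (e i : ℝ → 𝔼 q)) (fun c => ?_) hn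
  refine applyAlong_mem_fieldsAlong hA hAM (hu n) ?_
  rw [Fintype.linearCombination_apply]
  exact (Submodule.sum_mem _ fun i _ => Submodule.smul_mem _ _ (hmem i) :
    ∑ i, c i • (e i : ℝ → 𝔼 q) ∈ fieldsAlong M u₀).1

end ViscosityGeodesic

end

open ViscosityGeodesic in
theorem theorem9p3 {q : ℕ} (m : ℕ) (ν : ℕ∞) (hν : 3 ≤ ν)
    (M : Set (EuclideanSpace ℝ (Fin q))) (hM : IsCompact M) (hMν : IsSubmanifold ν m M)
    (σ : ℕ → ℝ) (hσ_pos : ∀ n, 0 < σ n) (hσ : Tendsto σ atTop (𝓝 0))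
    (u : ℕ → ℝ → EuclideanSpace ℝ (Fin q))
    (hu_crit : ∀ n, IsCritical M (σ n) (u n))
    (hu_speed : ∀ n s t, ‖deriv (u n) s‖ = ‖deriv (u n) t‖)
    (hu_entropy : Tendsto (fun n => σ n ^ 2 *
      ∫ t in (0 : ℝ)..(2 * π), geodesicCurvature M (u n) t ^ 2 * ‖deriv (u n) t‖) atTop (𝓝 0))
    (u₀ : ℝ → EuclideanSpace ℝ (Fin q)) (hu₀ : IsClosedGeodesic M u₀)
    (hu_unif : TendstoUniformly u u₀ atTop)
    (hu_deriv : ∀ᵐ t, Tendsto (fun n => deriv (u n) t) atTop (𝓝 (deriv u₀ t))) :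
    index M 0 u₀ ≤ liminf (fun n => index M (σ n) (u n)) atTop := by
  obtain ⟨A, hA, hAM⟩ := exists_contDiff_extension_tangentProj hν hM.isClosed hMν
  exact index_le_liminf hM hA hAM hσ (fun n => (hu_crit n).1) hu_speed hu_entropy hu₀.1
    (Eventually.of_forall fun t => hu_unif.tendsto_at t) hu_deriv
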